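/- Theorem 5.1. Let $\mathcal T$ be the space of real symmetric tridiagonal $3\times 3$ matrices with spectrum $\{-1,0,1\}$, and let $P_0=\begin{pmatrix}0&1&0\\1&0&0\\0&0&0\end{pmatrix}\in\mathcal T$. For $T\in\mathcal T$ let $\omega(T)$ be the eigenvalue of the bottom $2\times2$ diagonal block of $T$ closest to $T_{33}$ (undefined if two distinct eigenvalues are equally close). Wilkinson's step is $\mathbf W(T)=Q^{*}TQ$, where $T-\omega(T)I=QR$ with $Q$ orthogonal and $R$ upper triangular with positive diagonal; when $T-\omega(T)I$ is singular with linearly independent first two columns, the same formula is used with $R_{11},R_{22}>0$ and $R_{33}=0$ (the result does not depend on the choice of $Q$). Otherwise $\mathbf W(T)$ is undefined. In particular $\mathbf W(P_0)=P_0$. Let $\Lambda^\pi=\mathrm{diag}(1,-1,0)$. A matrix $T\in\mathcal T$ has bidiagonal coordinates $(x,y)\in\mathbb R^2$ if $T=Q^{*}\Lambda^\pi Q$ with $Q$ orthogonal, $Q=LU$ with $L$ lower unipotent and $U$ upper triangular with positive diagonal, and $L^{-1}\Lambda^\pi L=\begin{pmatrix}1&0&0\\x&-1&0\\0&y&0\end{pmatrix}$.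 These are coordinates on an open set $\mathcal U\subset\mathcal T$ containing $P_0$, which has coordinates $(2,0)$. There is an open neighbourhood $\mathcal A\subset\mathcal U$ of $P_0$ in $\mathcal T$ such that the set $\mathcal X$ of all $T\in\mathcal A$ for which $\mathbf W^k(T)$ is defined for all $k$ and $\lim_{k\to\infty}\mathbf W^k(T)=P_0$ has the following properties. 1. $\mathcal X$ is closed in $\mathcal A$ and has zero measure (its image in the coordinates $(x,y)$ is Lebesgue-null). 2. $\mathbf W$ is defined on $\mathcal X$ and $\mathbf W(\mathcal X)\subset\mathcal X$. 3. On $\mathcal X$ the iteration converges to $P_0$ strictly quadratically: for each $T_0\in\mathcal X$ there are constants $c,C>0$ such that $T_k=\mathbf W^k(T_0)$ satisfies $c\,|(T_k)_{32}|^2\le|(T_{k+1})_{32}|\le C\,|(T_k)_{32}|^2$ for all $k\ge0$. 4. The part of $\mathcal X$ with $y>0$ is homeomorphic to the product of the Cantor set and an open interval. -/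

import Mathlib

open Filter Topology MeasureTheory

namespace Wilkinson

/-- Real `3 × 3` matrices, with the entrywise topology. -/
abbrev Mat3 : Type := Matrix (Fin 3) (Fin 3) ℝ

/-- The isospectral manifold of real symmetric tridiagonal `3 × 3` matrices with spectrum
`{-1, 0, 1}` (automatically simple). -/
def isospectral : Set Mat3 :=
  {T | T.IsSymm ∧ T 0 2 = 0 ∧ spectrum ℝ T = {-1, 0, 1}}

/-- The matrix with bottom entry `0` and top block `[[0, 1], [1, 0]]`. -/
def P₀ : Mat3 := !![0, 1, 0; 1, 0, 0; 0, 0, 0]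

/-- The bottom `2 × 2` diagonal block of `T`. -/
def bottomBlock (T : Mat3) : Matrix (Fin 2) (Fin 2) ℝ :=
  !![T 1 1, T 1 2; T 2 1, T 2 2]

/-- `s` is the Wilkinson shift of `T`: the eigenvalue of the bottom `2 × 2` block which is closest
to the bottom entry. There is no shift when two distinct eigenvalues are equally close. -/
def IsShift (T : Mat3) (s : ℝ) : Prop :=
  s ∈ spectrum ℝ (bottomBlock T) ∧
    ∀ μ ∈ spectrum ℝ (bottomBlock T), μ ≠ s → |s - T 2 2| < |μ - T 2 2|

/-- `M = Q R` with `Q` orthogonal and `R` upper triangular with positive diagonal entries, except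
that the last one is only required to be nonnegative. If `M` is invertible then this is the usual
`QR` factorization, with positive diagonal. If `M` is singular with independent first two columns,
the last diagonal entry of `R` vanishes and `Q` is unique up to the sign of its last column. -/
def IsQR (M Q R : Mat3) : Prop :=
  Q.transpose * Q = 1 ∧ (∀ i j, j < i → R i j = 0) ∧
    0 < R 0 0 ∧ 0 < R 1 1 ∧ 0 ≤ R 2 2 ∧ M = Q * R

/-- The graph of Wilkinson's step: `T' = Qᵀ T Q`, where `T - s I = Q R` and `s` is the Wilkinson
shift. If `T - s I` is singular, the last row of `R` is zero, hence `T' = R Q + s I` has vanishing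
`(3,2)` entry and does not depend on the choice of `Q`; this is the continuous extension of the step
across such (removable) singularities. In particular `P₀` is a fixed point. -/
def Step (T T' : Mat3) : Prop :=
  ∃ (s : ℝ) (Q R : Mat3), IsShift T s ∧ IsQR (T - s • (1 : Mat3)) Q R ∧
    T' = Q.transpose * T * Q

/-- `S` is an orbit of Wilkinson's step: all its iterates are defined. -/
def IsOrbit (S : ℕ → Mat3) : Prop := ∀ k, Step (S k) (S (k + 1))

/-- The diagonal matrix `Λ^π = diag(1, -1, 0)`. -/
def Lam : Mat3 := !![1, 0, 0; 0, -1, 0; 0, 0, 0]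

/-- The lower bidiagonal matrix with diagonal `1, -1, 0` and subdiagonal `x, y`. -/
def bidiag (x y : ℝ) : Mat3 := !![1, 0, 0; x, -1, 0; 0, y, 0]

/-- `T` has bidiagonal coordinates `(x, y)` with respect to the ordering `1, -1, 0` of the
spectrum: `T = Qᵀ Λ^π Q` with `Q` orthogonal, `Q = L U` with `L` lower unipotent and `U` upper
triangular with positive diagonal, and `L⁻¹ Λ^π L` is lower bidiagonal with subdiagonal `x, y`. -/
def HasCoords (T : Mat3) (x y : ℝ) : Prop :=
  ∃ Q L U : Mat3, Q.transpose * Q = 1 ∧ T = Q.transpose * Lam * Q ∧ Q = L * U ∧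
    (∀ i j, i < j → L i j = 0) ∧ (∀ i, L i i = 1) ∧
    (∀ i j, j < i → U i j = 0) ∧ (∀ i, 0 < U i i) ∧
    L⁻¹ * Lam * L = bidiag x y

/-- The domain of the bidiagonal coordinates. -/
def chartDomain : Set Mat3 := {T | T ∈ isospectral ∧ ∃ x y, HasCoords T x y}

end Wilkinson

namespace Wilkinson

/-! In bidiagonal coordinates a QR step with shift `s` only rescales: `x` is multiplied by `(1 + s)
/ (1 - s)` and `y` by `|s| / (1 + s)`. With `u = log (x / 2)`, `q = √(2 x) y` and `s = tanh h`, this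
reads `u ↦ u + 2 h`, `q ↦ q sinh |h|`, and `s` is an eigenvalue of the bottom block exactly when `2
sinh h sinh (h - u) = q²`. Wilkinson's choice is the root `h` of sign opposite to `u` and absolute
value `gap (u, q)`; on `u = 0`, `q ≠ 0` two eigenvalues are equally close. Near `P₀` the iteration
is therefore the explicit plane map `planeStep`, discontinuous across `u = 0`.

For small `q` the quantity `|u| - 2 |q|` never decreases while `|q|` shrinks at least sixteenfold,
so an orbit converges to the origin exactly when it stays in a cone around `|u| ≤ 2 |q|`, and it
must then also keep away from `u = 0` (`mem_stableSet_of_tendsto`, `le_of_branch_mem_cone`). Inside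
the cone `gap` is comparable to `|q|`, so `q` is squared up to constants: the rate is quadratic.

Each orbit with `q > 0` that stays in the cone is coded by the sides of `u = 0` that it visits. The
map never contracts nearly horizontal displacements (`branch_expanding`) while the cone narrows
geometrically, so the itinerary and `q` determine `u`. Conversely, the image of an arc crossing one
half-cone crosses both half-cones, so nested intervals realize every itinerary
(`exists_branchOrbit_mem`). This gives a homeomorphism with `(ℕ → Bool)` times an interval. Covering
a horizontal slice by `2 ^ n` sets of diameter at most `16 ^ (-n)` gives measure zero.

The remaining work is an explicit bidiagonal chart, its continuous inverse, and the identification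
of Wilkinson's step with `planeStep` in this chart. -/

open Real

/-! ### The gap and the plane map in logarithmic coordinates. -/

/-- Half of the increment `θ - |u|`, where `cosh θ = cosh u + q²`. In the logarithmic coordinates
`u = log (x / 2)`, `q = √(2 x) y` this determines the Wilkinson shift. -/
noncomputable def gap (p : ℝ × ℝ) : ℝ := (arcosh (cosh p.1 + p.2 ^ 2) - |p.1|) / 2

theorem one_le_cosh_add_sq (p : ℝ × ℝ) : 1 ≤ cosh p.1 + p.2 ^ 2 := by
  nlinarith [one_le_cosh p.1, sq_nonneg p.2]

theorem gap_nonneg (p : ℝ × ℝ) : 0 ≤ gap p := by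
  have h : arcosh (cosh |p.1|) ≤ arcosh (cosh p.1 + p.2 ^ 2) := by
    rw [cosh_abs]
    exact (arcosh_le_arcosh (cosh_pos _) (lt_of_lt_of_le one_pos (one_le_cosh_add_sq p))).2
      (by nlinarith [sq_nonneg p.2])
  rw [arcosh_cosh (abs_nonneg _)] at h
  unfold gap
  linarith

theorem two_sinh_mul_sinh (a e : ℝ) : 2 * (sinh (a + e) * sinh e) = cosh (a + 2 * e) - cosh a := by
  have h1 : a + 2 * e = (a + e) + e := by ring
  have h2 : cosh a = cosh ((a + e) - e) := by ring_nf
  rw [h2, h1, cosh_add, cosh_sub]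
  ring

/-- This is the eigenvalue equation of the bottom block after the shift is written as a hyperbolic
tangent; it replaces the definition of `gap` in most estimates. -/
theorem gap_eq (p : ℝ × ℝ) : 2 * (sinh (|p.1| + gap p) * sinh (gap p)) = p.2 ^ 2 := by
  rw [two_sinh_mul_sinh]
  have : |p.1| + 2 * gap p = arcosh (cosh p.1 + p.2 ^ 2) := by unfold gap; ring
  rw [this, cosh_arcosh (one_le_cosh_add_sq p), cosh_abs]
  ring

theorem continuous_gap : Continuous gap := by
  unfold gap
  have : Continuous fun p : ℝ × ℝ => arcosh (cosh p.1 + p.2 ^ 2) :=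
    continuousOn_arcosh.comp_continuous (by fun_prop) one_le_cosh_add_sq
  fun_prop

theorem gap_neg_right (u q : ℝ) : gap (u, -q) = gap (u, q) := by simp [gap]

theorem sinh_gap_nonneg (p : ℝ × ℝ) : 0 ≤ sinh (gap p) := sinh_nonneg_iff.2 (gap_nonneg p)

theorem gap_pos {p : ℝ × ℝ} (h : p.2 ≠ 0) : 0 < gap p := by
  rcases (gap_nonneg p).eq_or_lt with h0 | h0
  · have := gap_eq p
    rw [← h0] at this
    simp [h, eq_comm] at this
  · exact h0

theorem gap_eq_zero {p : ℝ × ℝ} (h : p.2 = 0) : gap p = 0 := by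
  have h1 := gap_eq p
  have h2 : sinh (gap p) ≤ sinh (|p.1| + gap p) := sinh_le_sinh.2 (by linarith [abs_nonneg p.1])
  have h3 := sinh_gap_nonneg p
  rw [h] at h1
  have : sinh (gap p) = 0 := by nlinarith
  simpa using this

/-- The tangent-line bound for `exp` at `b` and `-a` gives the Lipschitz constant `(exp b + exp
(-a)) / 2`, at most `19/18` here. -/
theorem sinh_sub_sinh_le {a b : ℝ} (ha : 0 ≤ a) (hab : a ≤ b) (hb : b ≤ 1 / 10) :
    sinh b - sinh a ≤ 12 / 11 * (b - a) := by
  have h1 : exp b * (a - b + 1) ≤ exp a := by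
    have := mul_le_mul_of_nonneg_left (add_one_le_exp (a - b)) (exp_pos b).le
    rwa [← exp_add, add_sub_cancel] at this
  have h2 : exp (-a) * (a - b + 1) ≤ exp (-b) := by
    have := mul_le_mul_of_nonneg_left (add_one_le_exp (a - b)) (exp_pos (-a)).le
    rwa [← exp_add, show -a + (a - b) = -b by ring] at this
  have h3 : exp (-a) ≤ 1 := exp_le_one_iff.2 (by linarith)
  have h4 : exp b ≤ 10 / 9 := by
    have h5 := add_one_le_exp (-b)
    have h6 : exp b * exp (-b) = 1 := by rw [← exp_add]; simp
    nlinarith [exp_pos b]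
  rw [sinh_eq, sinh_eq]
  nlinarith

theorem sub_le_sinh_sub_sinh {a b : ℝ} (hab : a ≤ b) : b - a ≤ sinh b - sinh a := by
  have : sinh a - a ≤ sinh b - b := sinh_sub_id_strictMono.monotone hab
  linarith

theorem sinh_le_mul {t : ℝ} (h0 : 0 ≤ t) (h1 : t ≤ 1 / 10) : sinh t ≤ 12 / 11 * t := by
  simpa using sinh_sub_sinh_le le_rfl h0 h1

/-- `gap_eq` gives `2 sinh² (gap p) ≤ q²`, and `3/4` exceeds `1/√2`. -/
theorem sinh_gap_le (p : ℝ × ℝ) : sinh (gap p) ≤ 3 / 4 * |p.2| := by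
  have h1 := gap_eq p
  have h2 : sinh (gap p) ≤ sinh (|p.1| + gap p) := sinh_le_sinh.2 (by linarith [abs_nonneg p.1])
  have h3 := sinh_gap_nonneg p
  refine abs_le_of_sq_le_sq' ?_ (by positivity) |>.2
  rw [mul_pow, sq_abs]
  nlinarith

theorem gap_le (p : ℝ × ℝ) : gap p ≤ 3 / 4 * |p.2| :=
  (self_le_sinh_iff.2 (gap_nonneg p)).trans (sinh_gap_le p)

/-- In the cone the other factor of `gap_eq` is at most `12/11 * (2 + 3/4) * |q| = 3 |q|`. This
lower bound rules out convergence faster than quadratic. -/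
theorem le_sinh_gap {p : ℝ × ℝ} (hu : |p.1| ≤ 2 * |p.2|) (hq : |p.2| ≤ 1 / 100) :
    |p.2| / 6 ≤ sinh (gap p) := by
  rcases eq_or_ne p.2 0 with h0 | h0
  · simpa [h0] using sinh_gap_nonneg p
  have h1 := gap_eq p
  have h2 := gap_le p
  have h3 := gap_nonneg p
  have h4 := sinh_le_mul (t := |p.1| + gap p) (by positivity) (by linarith)
  have h5 : 0 < |p.2| := abs_pos.2 h0
  have h6 := sinh_gap_nonneg p
  rw [← sq_abs] at h1
  by_contra! h
  nlinarith [mul_le_mul_of_nonneg_right (show sinh (|p.1| + gap p) ≤ 3 * |p.2| by linarith) h6]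

theorem le_gap {p : ℝ × ℝ} (hu : |p.1| ≤ 2 * |p.2|) (hq : |p.2| ≤ 1 / 100) : |p.2| / 7 ≤ gap p := by
  have h1 := le_sinh_gap hu hq
  have h2 := sinh_le_mul (gap_nonneg p) (by linarith [gap_le p])
  have := abs_nonneg p.2
  linarith

/-- `1` for `true` and `-1` for `false`. -/
def sgn (t : Bool) : ℝ := if t then 1 else -1

theorem sgn_mul_self (t : Bool) : sgn t * sgn t = 1 := by cases t <;> simp [sgn]

theorem abs_sgn (t : Bool) : |sgn t| = 1 := by cases t <;> simp [sgn]

/-- Wilkinson's step in logarithmic coordinates, continued analytically from one side of the line of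
discontinuity `u = 0`. -/
noncomputable def branch (t : Bool) (p : ℝ × ℝ) : ℝ × ℝ :=
  (p.1 - 2 * sgn t * gap p, p.2 * sinh (gap p))

/-- The side of the line of discontinuity on which a point lies. -/
noncomputable def side (p : ℝ × ℝ) : Bool := decide (0 < p.1)

/-- Wilkinson's step in logarithmic coordinates. -/
noncomputable def planeStep (p : ℝ × ℝ) : ℝ × ℝ := branch (side p) p

theorem continuous_branch (t : Bool) : Continuous (branch t) := by
  unfold branch
  have := continuous_gap
  have := continuous_sinh.comp this
  fun_prop

theorem sgn_side_mul (p : ℝ × ℝ) : sgn (side p) * p.1 = |p.1| := by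
  by_cases h : 0 < p.1
  · simp [side, sgn, h, abs_of_pos h]
  · simp [side, sgn, h, abs_of_nonpos (not_lt.1 h)]

theorem side_eq {p : ℝ × ℝ} {t : Bool} (h : 0 < sgn t * p.1) : side p = t := by
  cases t
  · simp [sgn, side] at *; linarith
  · simpa [sgn, side] using h

theorem abs_branch_snd (t : Bool) (p : ℝ × ℝ) : |(branch t p).2| = |p.2| * sinh (gap p) := by
  simp [branch, abs_mul, abs_of_nonneg (sinh_gap_nonneg p)]

theorem abs_branch_snd_le (t : Bool) (p : ℝ × ℝ) : |(branch t p).2| ≤ 3 / 4 * |p.2| ^ 2 := by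
  rw [abs_branch_snd]
  nlinarith [sinh_gap_le p, abs_nonneg p.2]

theorem le_abs_branch_snd (t : Bool) {p : ℝ × ℝ} (hu : |p.1| ≤ 2 * |p.2|)
    (hq : |p.2| ≤ 1 / 100) : |p.2| ^ 2 / 6 ≤ |(branch t p).2| := by
  rw [abs_branch_snd]
  nlinarith [le_sinh_gap hu hq, abs_nonneg p.2]

theorem abs_branch_snd_le_div (t : Bool) {p : ℝ × ℝ} (hq : |p.2| ≤ 1 / 100) :
    |(branch t p).2| ≤ |p.2| / 16 := by
  nlinarith [abs_branch_snd_le t p, abs_nonneg p.2]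

/-- The step moves `u` by at most `3/2 |q|`, and the new `2 |q|` is at most `|q| / 8`. Hence a point
that leaves the cone `|u| ≤ 2 |q|` never returns, nor can it tend to the origin. -/
theorem abs_sub_le_branch (t : Bool) {p : ℝ × ℝ} (hq : |p.2| ≤ 1 / 100) :
    |p.1| - 2 * |p.2| ≤ |(branch t p).1| - 2 * |(branch t p).2| := by
  have h1 := abs_branch_snd_le_div t hq
  have h2 := gap_le p
  have h3 : |p.1| - |2 * sgn t * gap p| ≤ |(branch t p).1| := abs_sub_abs_le_abs_sub _ _
  rw [abs_mul, abs_mul, abs_sgn, abs_of_nonneg (gap_nonneg p)] at h3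
  have := abs_nonneg p.2
  norm_num at h3
  linarith

theorem sgn_mul_branch_fst (t : Bool) (p : ℝ × ℝ) :
    sgn t * (branch t p).1 = sgn t * p.1 - 2 * gap p := by
  simp only [branch]
  linear_combination (-2 * gap p) * sgn_mul_self t

theorem abs_fst_branch (t : Bool) (p : ℝ × ℝ) : |(branch t p).1| = |sgn t * p.1 - 2 * gap p| := by
  rw [← sgn_mul_branch_fst, abs_mul, abs_sgn, one_mul]

theorem abs_planeStep_fst_le (p : ℝ × ℝ) : |(planeStep p).1| ≤ max |p.1| (3 / 2 * |p.2|) := by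
  rw [planeStep, abs_fst_branch, sgn_side_mul, abs_le]
  have h1 := gap_le p
  have h2 := gap_nonneg p
  have h3 := le_max_left |p.1| (3 / 2 * |p.2|)
  have h4 := le_max_right |p.1| (3 / 2 * |p.2|)
  have := abs_nonneg p.1
  constructor <;> linarith

/-! ### Horizontal expansion inside the cone. -/

/-- If a point and its image lie in the cone `|u| ≤ 2 |q|`, then the point is far from the
line of discontinuity. -/
theorem le_of_branch_mem_cone {t : Bool} {p : ℝ × ℝ} (hq : |p.2| ≤ 1 / 100) (hu : |p.1| ≤ 2 * |p.2|)
    (h : |(branch t p).1| ≤ 2 * |(branch t p).2|) : |p.2| / 4 ≤ sgn t * p.1 := by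
  have h1 := le_gap hu hq
  have h2 := abs_branch_snd_le t p
  rw [abs_fst_branch] at h
  have h3 := (abs_le.1 h).1
  nlinarith [abs_nonneg p.2]

/-- For fixed `q` the gap decreases in `|u|`. A nearly horizontal displacement changes `q²` too
little to reverse this: otherwise the left side of `gap_eq` would grow too much. -/
theorem gap_le_gap_of_expanding {p r : ℝ × ℝ} (hp : 0 < p.2) (hp' : p.2 ≤ 1 / 100) (hr : 0 < r.2)
    (hpu : |p.1| ≤ 2 * p.2) (hru : |r.1| ≤ 2 * r.2) (h : |p.1| ≤ |r.1|)
    (hq : |r.2 - p.2| ≤ (|r.1| - |p.1|) / 8) : gap r ≤ gap p := by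
  by_contra! hlt
  have h1 := gap_eq p
  have h2 := gap_eq r
  have h3 : p.2 / 6 ≤ sinh (gap p) := by
    have := le_sinh_gap (p := p) (by rwa [abs_of_pos hp]) (by rwa [abs_of_pos hp])
    rwa [abs_of_pos hp] at this
  have h4 : sinh (gap p) < sinh (gap r) := sinh_lt_sinh.2 hlt
  have h5 := sub_le_sinh_sub_sinh (show |p.1| + gap p ≤ |r.1| + gap r by linarith)
  have h6 : 0 ≤ sinh (|p.1| + gap p) := sinh_nonneg_iff.2 (by linarith [abs_nonneg p.1, gap_nonneg p])
  have h7 := abs_le.1 hq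
  have h8 := abs_nonneg p.1
  have h9 : (r.2 - p.2) * (r.2 + p.2) ≤ (|r.1| - |p.1|) / 8 * (7 / 3 * p.2) := by
    -- The hypotheses give `r.2 - p.2 ≤ |r.1| / 8 ≤ r.2 / 4`, so `r.2 ≤ 4/3 * p.2`. The resulting
    -- `7/48` is below the `1/6` from `le_sinh_gap`.
    have : r.2 + p.2 ≤ 7 / 3 * p.2 := by linarith
    calc (r.2 - p.2) * (r.2 + p.2) ≤ (|r.1| - |p.1|) / 8 * (r.2 + p.2) := by
          gcongr
          exact h7.2
      _ ≤ _ := by gcongr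
  have h10 : sinh (|r.1| + gap r) * sinh (gap r) - sinh (|p.1| + gap p) * sinh (gap p) ≥
      (|r.1| - |p.1| + (gap r - gap p)) * sinh (gap p) := by
    have e1 : 0 ≤ sinh (|r.1| + gap r) := by linarith
    nlinarith
  have h11 : (|r.1| - |p.1| + (gap r - gap p)) * sinh (gap p) > (|r.1| - |p.1|) * (p.2 / 6) := by
    have : (|r.1| - |p.1|) * (p.2 / 6) ≤ (|r.1| - |p.1|) * sinh (gap p) := by gcongr
    have : 0 < (gap r - gap p) * sinh (gap p) := mul_pos (by linarith) (by linarith)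
    nlinarith
  nlinarith

/-- The branches of the step expand horizontal directions. -/
theorem branch_expanding {t : Bool} {p r : ℝ × ℝ} (hp : 0 < p.2) (hp' : p.2 ≤ 1 / 100)
    (hr : 0 < r.2) (hr' : r.2 ≤ 1 / 100) (hpt : 0 ≤ sgn t * p.1) (hrt : 0 ≤ sgn t * r.1)
    (hpu : |p.1| ≤ 2 * p.2) (hru : |r.1| ≤ 2 * r.2) (hq : |r.2 - p.2| ≤ |r.1 - p.1| / 8) :
    |r.1 - p.1| ≤ |(branch t r).1 - (branch t p).1| ∧
      |(branch t r).2 - (branch t p).2| ≤ |(branch t r).1 - (branch t p).1| / 8 := by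
  wlog h : |p.1| ≤ |r.1| generalizing p r
  · have := this hr hr' hp hp' hrt hpt hru hpu (by rwa [abs_sub_comm, abs_sub_comm p.1])
      (le_of_not_ge h)
    rwa [abs_sub_comm r.1, abs_sub_comm (branch t r).1, abs_sub_comm (branch t r).2]
  have key : ∀ s : ℝ × ℝ, 0 ≤ sgn t * s.1 → sgn t * s.1 = |s.1| := fun s hs => by
    rw [← abs_of_nonneg hs, abs_mul, abs_sgn, one_mul]
  have e1 : |r.1 - p.1| = |r.1| - |p.1| := by
    rw [← key p hpt, ← key r hrt, ← mul_sub, ← one_mul |r.1 - p.1|, ← abs_sgn t, ← abs_mul,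
      abs_of_nonneg]
    rw [mul_sub, key p hpt, key r hrt]; linarith
  rw [e1] at hq ⊢
  have hg := gap_le_gap_of_expanding hp hp' hr hpu hru h hq
  have e2 : |(branch t r).1 - (branch t p).1| = |r.1| - |p.1| + 2 * (gap p - gap r) := by
    rw [← one_mul |(branch t r).1 - (branch t p).1|, ← abs_sgn t, ← abs_mul, mul_sub,
      sgn_mul_branch_fst, sgn_mul_branch_fst, key p hpt, key r hrt, abs_of_nonneg] <;> linarith
  rw [e2]
  refine ⟨by linarith, ?_⟩
  have h1 := gap_le p
  rw [abs_of_pos hp] at h1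
  have h2 := sinh_sub_sinh_le (gap_nonneg r) hg (by linarith)
  have h3 := sub_le_sinh_sub_sinh hg
  have h4 := sinh_gap_nonneg r
  have h5 : sinh (gap r) ≤ 1 / 2 := by
    have := sinh_gap_le r
    rw [abs_of_pos hr] at this
    linarith
  -- The first term is controlled by the old slope; the second by the difference of the gaps, twice
  -- which is gained in the horizontal direction.
  have e3 : (branch t r).2 - (branch t p).2 =
      (r.2 - p.2) * sinh (gap r) - p.2 * (sinh (gap p) - sinh (gap r)) := by
    simp only [branch]; ring
  rw [e3]
  have h6 := abs_le.1 hq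
  have h7 : |(r.2 - p.2) * sinh (gap r)| ≤ (|r.1| - |p.1|) / 8 * (1 / 2) := by
    rw [abs_mul, abs_of_nonneg h4]
    exact mul_le_mul hq h5 h4 (by linarith)
  have h8 : |p.2 * (sinh (gap p) - sinh (gap r))| ≤ 1 / 100 * (12 / 11 * (gap p - gap r)) := by
    rw [abs_mul, abs_of_pos hp, abs_of_nonneg (by linarith)]
    exact mul_le_mul hp' h2 (by linarith) (by norm_num)
  refine (abs_sub _ _).trans ?_
  linarith

/-! ### Realizing every itinerary by nested intervals. -/

/-- Stop at the first time the value `1` is reached, and start at the last zero before it. -/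
theorem exists_crossing_of_le {f : ℝ → ℝ} (hf : Continuous f) {a b : ℝ} (hab : a ≤ b)
    (ha : f a ≤ 0) (hb : 1 ≤ f b) :
    ∃ a' b', a ≤ a' ∧ a' ≤ b' ∧ b' ≤ b ∧ f a' = 0 ∧ f b' = 1 ∧
      ∀ x ∈ Set.Icc a' b', f x ∈ Set.Icc (0 : ℝ) 1 := by
  obtain ⟨b', ⟨⟨hb1, hb2⟩, hb3⟩, hb4⟩ : ∃ x, IsLeast (Set.Icc a b ∩ f ⁻¹' {1}) x := by
    refine (isCompact_Icc.inter_right (isClosed_singleton.preimage hf)).exists_isLeast ?_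
    obtain ⟨x, hx, hx'⟩ := intermediate_value_Icc hab hf.continuousOn
      (show (1 : ℝ) ∈ Set.Icc (f a) (f b) from ⟨by linarith, hb⟩)
    exact ⟨x, hx, hx'⟩
  have hb3 : f b' = 1 := hb3
  obtain ⟨a', ⟨⟨ha1, ha2⟩, ha3⟩, ha4⟩ : ∃ x, IsGreatest (Set.Icc a b' ∩ f ⁻¹' {0}) x := by
    refine (isCompact_Icc.inter_right (isClosed_singleton.preimage hf)).exists_isGreatest ?_
    obtain ⟨x, hx, hx'⟩ := intermediate_value_Icc hb1 hf.continuousOn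
      (show (0 : ℝ) ∈ Set.Icc (f a) (f b') from ⟨ha, by linarith⟩)
    exact ⟨x, hx, hx'⟩
  have ha3 : f a' = 0 := ha3
  refine ⟨a', b', ha1, ha2, hb2, ha3, hb3, fun x hx => ⟨?_, ?_⟩⟩
  · by_contra! h
    obtain ⟨y, hy, hy'⟩ := intermediate_value_Icc hx.2 hf.continuousOn
      (show (0 : ℝ) ∈ Set.Icc (f x) (f b') from ⟨h.le, by linarith⟩)
    have := ha4 ⟨⟨ha1.trans (hx.1.trans hy.1), hy.2⟩, hy'⟩
    have : x = a' := le_antisymm (hy.1.trans this) hx.1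
    subst this; linarith
  · by_contra! h
    obtain ⟨y, hy, hy'⟩ := intermediate_value_Icc hx.1 hf.continuousOn
      (show (1 : ℝ) ∈ Set.Icc (f a') (f x) from ⟨by linarith, h.le⟩)
    have := hb4 ⟨⟨ha1.trans hy.1, hy.2.trans (hx.2.trans hb2)⟩, hy'⟩
    have : x = b' := le_antisymm hx.2 (this.trans hy.2)
    subst this; linarith

theorem exists_crossing {f : ℝ → ℝ} (hf : Continuous f) {a b : ℝ} (ha : f a ≤ 0) (hb : 1 ≤ f b) :
    ∃ a' b', Set.uIcc a' b' ⊆ Set.uIcc a b ∧ f a' = 0 ∧ f b' = 1 ∧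
      ∀ x ∈ Set.uIcc a' b', f x ∈ Set.Icc (0 : ℝ) 1 := by
  rcases le_total a b with hab | hab
  · obtain ⟨a', b', h1, h2, h3, h4, h5, h6⟩ := exists_crossing_of_le hf hab ha hb
    refine ⟨a', b', ?_, h4, h5, by rwa [Set.uIcc_of_le h2]⟩
    rw [Set.uIcc_of_le h2, Set.uIcc_of_le hab]
    exact Set.Icc_subset_Icc h1 h3
  · obtain ⟨a', b', h1, h2, h3, h4, h5, h6⟩ := exists_crossing_of_le (f := fun x => f (-x))
      (hf.comp continuous_neg) (neg_le_neg hab) (by simpa using ha) (by simpa using hb)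
    refine ⟨-a', -b', ?_, h4, h5, fun x hx => ?_⟩
    · rw [Set.uIcc_of_ge (neg_le_neg h2), Set.uIcc_of_ge hab]
      exact Set.Icc_subset_Icc (by linarith) (by linarith)
    · rw [Set.uIcc_of_ge (neg_le_neg h2)] at hx
      simpa using h6 (-x) ⟨by linarith [hx.2], by linarith [hx.1]⟩

/-- The orbit of a point under prescribed branches of the step. -/
noncomputable def branchOrbit (σ : ℕ → Bool) (p : ℝ × ℝ) : ℕ → ℝ × ℝ
  | 0 => p
  | n + 1 => branch (σ n) (branchOrbit σ p n)

theorem continuous_branchOrbit (σ : ℕ → Bool) (n : ℕ) : Continuous fun p => branchOrbit σ p n := by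
  induction n with
  | zero => exact continuous_id
  | succ n ih => exact (continuous_branch _).comp ih

theorem branchOrbit_snd_pos (σ : ℕ → Bool) {p : ℝ × ℝ} (hp : 0 < p.2) (n : ℕ) :
    0 < (branchOrbit σ p n).2 := by
  induction n with
  | zero => exact hp
  | succ n ih => exact mul_pos ih (sinh_pos_iff.2 (gap_pos ih.ne'))

theorem abs_branchOrbit_snd_le (σ : ℕ → Bool) {p : ℝ × ℝ} (hp : |p.2| ≤ 1 / 100) (n : ℕ) :
    |(branchOrbit σ p n).2| ≤ (1 / 16) ^ n * |p.2| ∧ |(branchOrbit σ p n).2| ≤ 1 / 100 := by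
  induction n with
  | zero => simpa [branchOrbit] using hp
  | succ n ih =>
    have := abs_branch_snd_le_div (σ n) ih.2
    have h0 := abs_nonneg (branchOrbit σ p n).2
    simp only [branchOrbit, pow_succ]
    constructor <;> linarith

/-- A half-cone next to the line of discontinuity. -/
def halfCone (t : Bool) : Set (ℝ × ℝ) := {p | 0 ≤ sgn t * p.1 ∧ sgn t * p.1 ≤ 2 * p.2}

theorem isClosed_halfCone (t : Bool) : IsClosed (halfCone t) := by
  have h1 : IsClosed {p : ℝ × ℝ | 0 ≤ sgn t * p.1} := isClosed_le (by fun_prop) (by fun_prop)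
  have h2 : IsClosed {p : ℝ × ℝ | sgn t * p.1 ≤ 2 * p.2} := isClosed_le (by fun_prop) (by fun_prop)
  exact h1.inter h2

theorem abs_le_of_mem_halfCone {t : Bool} {p : ℝ × ℝ} (h : p ∈ halfCone t) : |p.1| ≤ 2 * p.2 := by
  have h1 := abs_of_nonneg h.1
  rw [abs_mul, abs_sgn, one_mul] at h1
  rw [h1]
  exact h.2

/-- The inner edge of a half-cone is thrown across `u = 0` and beyond the opposite half-cone;
`le_sgn_mul_fst_branch` shows that the outer edge lands beyond the outer edge. Together they make
the image of a crossing arc cross both half-cones. -/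
theorem sgn_mul_fst_branch_le {t : Bool} {p : ℝ × ℝ} (hq : 0 < p.2) (hq' : p.2 ≤ 1 / 100)
    (h : p.1 = 0) : sgn t * (branch t p).1 ≤ -(2 * (branch t p).2) := by
  have h1 := le_gap (p := p) (by rw [h]; simp) (by rwa [abs_of_pos hq])
  have h2 := abs_branch_snd_le t p
  have h3 := le_abs_self (branch t p).2
  rw [sgn_mul_branch_fst, h]
  rw [abs_of_pos hq] at h1 h2
  nlinarith

theorem le_sgn_mul_fst_branch {t : Bool} {p : ℝ × ℝ} (hq : 0 < p.2) (hq' : p.2 ≤ 1 / 100)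
    (h : sgn t * p.1 = 2 * p.2) : 2 * (branch t p).2 ≤ sgn t * (branch t p).1 := by
  have h1 := gap_le p
  have h2 := abs_branch_snd_le t p
  have h3 := le_abs_self (branch t p).2
  rw [sgn_mul_branch_fst, h]
  rw [abs_of_pos hq] at h1 h2
  nlinarith

/-- The induction maintains an interval whose `n`-th image crosses the prescribed half-cone from
edge to edge. Unordered intervals are used because the direction of the crossing depends on the
itinerary. -/
theorem exists_uIcc_branchOrbit (σ : ℕ → Bool) {q : ℝ} (hq : 0 < q) (hq' : q ≤ 1 / 100) (n : ℕ) :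
    ∃ a b, Set.uIcc a b ⊆ Set.Icc (-1) 1 ∧ (branchOrbit σ (a, q) n).1 = 0 ∧
      sgn (σ n) * (branchOrbit σ (b, q) n).1 = 2 * (branchOrbit σ (b, q) n).2 ∧
      ∀ k ≤ n, ∀ x ∈ Set.uIcc a b, branchOrbit σ (x, q) k ∈ halfCone (σ k) := by
  induction n with
  | zero =>
    refine ⟨0, sgn (σ 0) * (2 * q), ?_, rfl, ?_, ?_⟩
    · refine Set.uIcc_subset_Icc ⟨by norm_num, by norm_num⟩ (abs_le.1 ?_)
      rw [abs_mul, abs_sgn, abs_of_pos (by positivity)]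
      linarith
    · simp only [branchOrbit]
      rw [← mul_assoc, sgn_mul_self, one_mul]
    · rintro k hk x hx
      obtain rfl : k = 0 := by omega
      simp only [branchOrbit, halfCone, Set.mem_ofPred_eq]
      generalize σ 0 = t at *
      cases t
      · rw [Set.uIcc_of_ge (by simp [sgn]; linarith)] at hx
        simp only [sgn] at *
        constructor <;> norm_num at * <;> linarith [hx.1, hx.2]
      · rw [Set.uIcc_of_le (by simp [sgn]; linarith)] at hx
        simp only [sgn] at *
        constructor <;> norm_num at * <;> linarith [hx.1, hx.2]
  | succ n ih =>
    obtain ⟨a, b, hI, ha, hb, hk⟩ := ih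
    have pos : ∀ m x, 0 < (branchOrbit σ (x, q) m).2 := fun m x => branchOrbit_snd_pos σ hq m
    have small : ∀ m x, (branchOrbit σ (x, q) m).2 ≤ 1 / 100 := fun m x =>
      (le_abs_self _).trans (abs_branchOrbit_snd_le σ (p := (x, q)) (by rwa [abs_of_pos hq]) m).2
    have cont : Continuous fun x => branchOrbit σ (x, q) (n + 1) :=
      (continuous_branchOrbit σ (n + 1)).comp (by fun_prop)
    -- Since `q > 0`, the prescribed half-cone is `0 ≤ f ≤ 1`, with the edges at `0` and `1`.
    set f : ℝ → ℝ := fun x => sgn (σ (n + 1)) * (branchOrbit σ (x, q) (n + 1)).1 /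
      (2 * (branchOrbit σ (x, q) (n + 1)).2) with hf
    have hfc : Continuous f := by
      refine (continuous_const.mul cont.fst).div (continuous_const.mul cont.snd) fun x => ?_
      have := pos (n + 1) x
      positivity
    have h1 := sgn_mul_fst_branch_le (t := σ n) (pos n a) (small n a) ha
    have h2 := le_sgn_mul_fst_branch (t := σ n) (pos n b) (small n b) hb
    change _ * (branchOrbit σ (a, q) (n + 1)).1 ≤ -(2 * (branchOrbit σ (a, q) (n + 1)).2) at h1
    change 2 * (branchOrbit σ (b, q) (n + 1)).2 ≤ _ * (branchOrbit σ (b, q) (n + 1)).1 at h2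
    have pa := pos (n + 1) a
    have pb := pos (n + 1) b
    obtain ⟨a', b', hsub, ha', hb', hx⟩ : ∃ a' b', Set.uIcc a' b' ⊆ Set.uIcc a b ∧ f a' = 0 ∧
        f b' = 1 ∧ ∀ x ∈ Set.uIcc a' b', f x ∈ Set.Icc (0 : ℝ) 1 := by
      -- Relative to the old side, the ratio `u / (2 q)` runs from at most `-1` to at least `1`. A
      -- change of side reverses its sign, so the endpoints exchange roles.
      by_cases hs : σ (n + 1) = σ n
      · refine exists_crossing hfc ?_ ?_ <;> simp only [hf, hs]
        · exact div_nonpos_of_nonpos_of_nonneg (by linarith) (by linarith)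
        · rwa [one_le_div (by linarith)]
      · have hs : sgn (σ (n + 1)) = - sgn (σ n) := by
          revert hs
          cases σ (n + 1) <;> cases σ n <;> simp [sgn]
        rw [Set.uIcc_comm]
        refine exists_crossing hfc ?_ ?_ <;> simp only [hf, hs]
        · exact div_nonpos_of_nonpos_of_nonneg (by linarith) (by linarith)
        · rw [one_le_div (by linarith)]
          linarith
    refine ⟨a', b', hsub.trans hI, ?_, ?_, fun k hkn x hxm => ?_⟩
    · have := (pos (n + 1) a').ne'
      have h3 := abs_sgn (σ (n + 1))
      simp only [hf, div_eq_zero_iff, mul_eq_zero] at ha'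
      rcases ha' with (h | h) | h
      · rw [h] at h3; simp at h3
      · exact h
      · simp [this] at h
    · have := pos (n + 1) b'
      rwa [hf, div_eq_one_iff_eq (by positivity)] at hb'
    · rcases hkn.eq_or_lt with rfl | hlt
      · have := pos (n + 1) x
        obtain ⟨h3, h4⟩ := hx x hxm
        simp only [hf] at h3 h4
        rw [div_le_one (by positivity)] at h4
        refine ⟨?_, h4⟩
        by_contra! h
        exact absurd h3 (not_le.2 (div_neg_of_neg_of_pos h (by positivity)))
      · exact hk k (by omega) x (hsub hxm)

/-- Compactness: the sets satisfying the first `n` constraints are closed, nonempty and nested. -/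
theorem exists_branchOrbit_mem (σ : ℕ → Bool) {q : ℝ} (hq : 0 < q) (hq' : q ≤ 1 / 100) :
    ∃ u, ∀ n, branchOrbit σ (u, q) n ∈ halfCone (σ n) := by
  let K : ℕ → Set ℝ := fun n =>
    Set.Icc (-1) 1 ∩ {x | ∀ k ≤ n, branchOrbit σ (x, q) k ∈ halfCone (σ k)}
  have hcl : ∀ n, IsClosed {x | ∀ k ≤ n, branchOrbit σ (x, q) k ∈ halfCone (σ k)} := fun n => by
    simp only [Set.ofPred_forall]
    refine isClosed_iInter fun k => isClosed_iInter fun _ => (isClosed_halfCone _).preimage ?_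
    exact (continuous_branchOrbit σ k).comp (by fun_prop)
  obtain ⟨u, hu⟩ := IsCompact.nonempty_iInter_of_sequence_nonempty_isCompact_isClosed K
    (fun n => Set.inter_subset_inter_right _ fun x hx k hk => hx k (by omega))
    (fun n => by
      obtain ⟨a, b, h1, -, -, h2⟩ := exists_uIcc_branchOrbit σ hq hq' n
      exact ⟨a, h1 Set.left_mem_uIcc, fun k hk => h2 k hk a Set.left_mem_uIcc⟩)
    (isCompact_Icc.inter_right (hcl 0)) (fun n => isClosed_Icc.inter (hcl n))
  exact ⟨u, fun n => (Set.mem_iInter.1 hu n).2 n le_rfl⟩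

/-! ### The stable set of the plane map. -/

/-- Points of the plane comparably close to both coordinate axes. -/
def cone : Set (ℝ × ℝ) := {p | |p.2| ≤ 1 / 100 ∧ |p.1| ≤ 2 * |p.2| ∧ |p.2| ≤ 4 * |p.1|}

/-- The points whose orbit stays in the cone; near the origin, these are the points whose orbit
converges to the origin. -/
def stableSet : Set (ℝ × ℝ) := {p | ∀ k, planeStep^[k] p ∈ cone}

theorem isClosed_cone : IsClosed cone := by
  have h1 : IsClosed {p : ℝ × ℝ | |p.2| ≤ 1 / 100} := isClosed_le (by fun_prop) (by fun_prop)
  have h2 : IsClosed {p : ℝ × ℝ | |p.1| ≤ 2 * |p.2|} := isClosed_le (by fun_prop) (by fun_prop)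
  have h3 : IsClosed {p : ℝ × ℝ | |p.2| ≤ 4 * |p.1|} := isClosed_le (by fun_prop) (by fun_prop)
  exact h1.inter (h2.inter h3)

theorem branch_of_snd_eq_zero (t : Bool) {p : ℝ × ℝ} (h : p.2 = 0) : branch t p = p := by
  ext <;> simp [branch, gap_eq_zero h, h]

theorem eventually_side_eq {p : ℝ × ℝ} (h : p.1 ≠ 0) : ∀ᶠ r in 𝓝 p, side r = side p := by
  have hpos : 0 < sgn (side p) * p.1 := by rw [sgn_side_mul]; exact abs_pos.2 h
  have hc : Continuous fun r : ℝ × ℝ => sgn (side p) * r.1 := by fun_prop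
  filter_upwards [hc.continuousAt.eventually (lt_mem_nhds hpos)] with r hr
  exact side_eq hr

theorem continuousAt_planeStep {p : ℝ × ℝ} (h : p.1 ≠ 0) : ContinuousAt planeStep p := by
  refine (continuous_branch (side p)).continuousAt.congr ?_
  filter_upwards [eventually_side_eq h] with r hr
  rw [planeStep, hr]

theorem continuousAt_planeStep_zero : ContinuousAt planeStep 0 := by
  have h0 : ∀ t, branch t 0 = 0 := fun t => branch_of_snd_eq_zero t rfl
  have h1 : ∀ t, Tendsto (branch t) (𝓝 0) (𝓝 0) := fun t => by
    simpa [h0] using (continuous_branch t).tendsto 0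
  have h2 : planeStep = fun p : ℝ × ℝ => if 0 < p.1 then branch true p else branch false p := by
    funext p
    by_cases h : 0 < p.1 <;> simp [planeStep, side, h]
  rw [ContinuousAt, planeStep, h0, h2]
  exact (h1 true).if' (h1 false)

/-- The cone meets the line of discontinuity `u = 0` only at the origin, where both branches agree.
This is what makes the stable set closed. -/
theorem continuousOn_planeStep : ContinuousOn planeStep cone := by
  intro p hp
  by_cases h : p.1 = 0
  · have h2 : p.2 = 0 := by simpa [h] using hp.2.2
    obtain rfl : p = 0 := Prod.ext h h2
    exact continuousAt_planeStep_zero.continuousWithinAt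
  · exact (continuousAt_planeStep h).continuousWithinAt

theorem isClosed_stableSet : IsClosed stableSet := by
  have key : ∀ n, IsClosed {p | ∀ k ≤ n, planeStep^[k] p ∈ cone} := by
    intro n
    induction n with
    | zero => simpa using isClosed_cone
    | succ n ih =>
      have : {p | ∀ k ≤ n + 1, planeStep^[k] p ∈ cone} =
          cone ∩ planeStep ⁻¹' {p | ∀ k ≤ n, planeStep^[k] p ∈ cone} := by
        ext p
        refine ⟨fun h => ⟨h 0 (by omega), fun k hk => h (k + 1) (by omega)⟩, fun h k hk => ?_⟩
        cases k with
        | zero => exact h.1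
        | succ k => exact h.2 k (by omega)
      rw [this]
      exact continuousOn_planeStep.preimage_isClosed_of_isClosed isClosed_cone ih
  have : stableSet = ⋂ n, {p | ∀ k ≤ n, planeStep^[k] p ∈ cone} := by
    ext p
    simp only [Set.mem_iInter]
    exact ⟨fun h n k _ => h k, fun h k => h k k le_rfl⟩
  rw [this]
  exact isClosed_iInter key

theorem planeStep_mem_stableSet {p : ℝ × ℝ} (h : p ∈ stableSet) : planeStep p ∈ stableSet :=
  fun k => h (k + 1)

theorem iterate_mem_stableSet {p : ℝ × ℝ} (h : p ∈ stableSet) (n : ℕ) :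
    planeStep^[n] p ∈ stableSet := fun k => by
  rw [← Function.iterate_add_apply]
  exact h _

theorem abs_iterate_snd_le {p : ℝ × ℝ} (hp : |p.2| ≤ 1 / 100) (n : ℕ) :
    |(planeStep^[n] p).2| ≤ (1 / 16) ^ n * |p.2| ∧ |(planeStep^[n] p).2| ≤ 1 / 100 := by
  induction n with
  | zero => simpa using hp
  | succ n ih =>
    have := abs_branch_snd_le_div (side (planeStep^[n] p)) ih.2
    have h0 := abs_nonneg (planeStep^[n] p).2
    simp only [Function.iterate_succ_apply', pow_succ, planeStep] at *
    constructor <;> linarith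

/-- Along the orbit `|u| - 2 |q|` is monotone with limit `0`, hence nonpositive throughout. The
third cone condition at time `n` then follows from the second one at time `n + 1`. -/
theorem mem_stableSet_of_tendsto {p : ℝ × ℝ} (hp : |p.2| ≤ 1 / 100)
    (h : Tendsto (fun k => planeStep^[k] p) atTop (𝓝 0)) : p ∈ stableSet := by
  have hs := fun n => (abs_iterate_snd_le hp n).2
  have hmono : Monotone fun n => |(planeStep^[n] p).1| - 2 * |(planeStep^[n] p).2| := by
    refine monotone_nat_of_le_succ fun n => ?_
    rw [Function.iterate_succ_apply']
    exact abs_sub_le_branch _ (hs n)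
  have hlim : Tendsto (fun n => |(planeStep^[n] p).1| - 2 * |(planeStep^[n] p).2|) atTop (𝓝 0) := by
    have : Continuous fun r : ℝ × ℝ => |r.1| - 2 * |r.2| := by fun_prop
    have h1 := (this.tendsto 0).comp h
    simp only [Prod.fst_zero, Prod.snd_zero, abs_zero, mul_zero, sub_zero] at h1
    exact h1
  have hu : ∀ n, |(planeStep^[n] p).1| ≤ 2 * |(planeStep^[n] p).2| := fun n => by
    linarith [hmono.ge_of_tendsto hlim n]
  refine fun n => ⟨hs n, hu n, ?_⟩
  have h1 := hu (n + 1)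
  rw [Function.iterate_succ_apply'] at h1
  have h2 := le_of_branch_mem_cone (hs n) (hu n) h1
  rw [sgn_side_mul] at h2
  linarith

theorem tendsto_of_mem_stableSet {p : ℝ × ℝ} (h : p ∈ stableSet) :
    Tendsto (fun k => planeStep^[k] p) atTop (𝓝 0) := by
  have hp := (h 0).1
  have h0 : Tendsto (fun n : ℕ => (1 / 16 : ℝ) ^ n * |p.2|) atTop (𝓝 0) := by
    simpa using (tendsto_pow_atTop_nhds_zero_of_lt_one (r := (1 / 16 : ℝ)) (by norm_num)
      (by norm_num)).mul_const |p.2|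
  have h2 : Tendsto (fun k => (planeStep^[k] p).2) atTop (𝓝 0) :=
    squeeze_zero_norm (fun n => (abs_iterate_snd_le hp n).1) h0
  have h1 : Tendsto (fun k => (planeStep^[k] p).1) atTop (𝓝 0) := by
    refine squeeze_zero_norm (fun n => (h n).2.1) ?_
    simpa using (h2.abs.const_mul 2)
  exact h1.prodMk_nhds h2

/-! ### Symbolic coding of the stable set. -/

/-- The sequence of sides of the line of discontinuity which an orbit visits. -/
noncomputable def itinerary (p : ℝ × ℝ) (n : ℕ) : Bool := side (planeStep^[n] p)

theorem branchOrbit_itinerary (p : ℝ × ℝ) (n : ℕ) :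
    branchOrbit (itinerary p) p n = planeStep^[n] p := by
  induction n with
  | zero => rfl
  | succ n ih => rw [branchOrbit, ih, Function.iterate_succ_apply', planeStep, itinerary]

/-- The stable points with positive second coordinate. -/
def stablePos : Set (ℝ × ℝ) := {p | p ∈ stableSet ∧ 0 < p.2 ∧ p.2 < 1 / 100}

theorem iterate_snd_pos {p : ℝ × ℝ} (hp : 0 < p.2) (n : ℕ) : 0 < (planeStep^[n] p).2 := by
  rw [← branchOrbit_itinerary]
  exact branchOrbit_snd_pos _ hp n

theorem iterate_fst_ne_zero {p : ℝ × ℝ} (h : p ∈ stableSet) (hp : 0 < p.2) (n : ℕ) :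
    (planeStep^[n] p).1 ≠ 0 := fun h0 => by
  have h1 := (h n).2.2
  have h2 := iterate_snd_pos hp n
  rw [h0, abs_of_pos h2] at h1
  simp at h1
  linarith

/-- Stable points with the same initial itinerary lie on nearby, nearly vertical curves. -/
theorem abs_sub_le_of_itinerary_eq {p r : ℝ × ℝ} (hp : p ∈ stableSet) (hp0 : 0 < p.2)
    (hr : r ∈ stableSet) (hr0 : 0 < r.2) {n : ℕ} (h : ∀ k < n, itinerary r k = itinerary p k) :
    |r.1 - p.1| ≤ 8 * |r.2 - p.2| + (1 / 16) ^ n := by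
  -- A steep displacement already satisfies the bound. A nearly horizontal one stays so and does not
  -- shrink for `n` steps, yet both endpoints end in a cone of width proportional to `16 ^ (-n)`.
  by_cases hq : |r.2 - p.2| ≤ |r.1 - p.1| / 8
  · have key : ∀ k ≤ n, |r.1 - p.1| ≤ |(planeStep^[k] r).1 - (planeStep^[k] p).1| ∧
        |(planeStep^[k] r).2 - (planeStep^[k] p).2| ≤
          |(planeStep^[k] r).1 - (planeStep^[k] p).1| / 8 := by
      intro k hk
      induction k with
      | zero => exact ⟨le_rfl, hq⟩
      | succ k ih =>
        obtain ⟨h1, h2⟩ := ih (by omega)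
        have hpk := iterate_snd_pos hp0 k
        have hrk := iterate_snd_pos hr0 k
        have cp := hp k
        have cr := hr k
        have hside : side (planeStep^[k] r) = side (planeStep^[k] p) := h k (by omega)
        have sp := sgn_side_mul (planeStep^[k] p)
        have sr := sgn_side_mul (planeStep^[k] r)
        simp only [cone, Set.mem_ofPred_eq, abs_of_pos hpk, abs_of_pos hrk] at cp cr
        have := branch_expanding (t := side (planeStep^[k] p)) hpk cp.1 hrk cr.1
          (by rw [sp]; exact abs_nonneg _) (by rw [← hside, sr]; exact abs_nonneg _)
          cp.2.1 cr.2.1 h2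
        rw [Function.iterate_succ_apply', Function.iterate_succ_apply', planeStep, planeStep, hside]
        exact ⟨h1.trans this.1, this.2⟩
    have h1 := (key n le_rfl).1
    have h2 := abs_sub (planeStep^[n] r).1 (planeStep^[n] p).1
    have h3 := (hp n).2.1
    have h4 := (hr n).2.1
    have h5 := (abs_iterate_snd_le (p := p) (hp 0).1 n).1
    have h6 := (abs_iterate_snd_le (p := r) (hr 0).1 n).1
    have h7 : |p.2| ≤ 1 / 100 := (hp 0).1
    have h8 : |r.2| ≤ 1 / 100 := (hr 0).1
    have h9 : (0 : ℝ) < (1 / 16) ^ n := by positivity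
    have h10 : (1 / 16 : ℝ) ^ n * |p.2| ≤ (1 / 16 : ℝ) ^ n * (1 / 100) := by gcongr
    have h11 : (1 / 16 : ℝ) ^ n * |r.2| ≤ (1 / 16 : ℝ) ^ n * (1 / 100) := by gcongr
    have h12 := abs_nonneg (r.2 - p.2)
    linarith
  · have : (0 : ℝ) < (1 / 16) ^ n := by positivity
    linarith

theorem tendsto_sixteenth_pow : Tendsto (fun n : ℕ => (1 / 16 : ℝ) ^ n) atTop (𝓝 0) :=
  tendsto_pow_atTop_nhds_zero_of_lt_one (by norm_num) (by norm_num)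

/-- The closed half-cones allow `u = 0`, where the prescribed branch need not be the actual one.
Membership at the next time excludes this by `le_of_branch_mem_cone`, so the branch orbit is a true
orbit. -/
theorem mem_stableSet_of_branchOrbit {σ : ℕ → Bool} {p : ℝ × ℝ} (hp : 0 < p.2)
    (hp' : p.2 ≤ 1 / 100) (h : ∀ n, branchOrbit σ p n ∈ halfCone (σ n)) :
    p ∈ stableSet ∧ itinerary p = σ := by
  have hs := fun n => (abs_branchOrbit_snd_le σ (p := p) (by rwa [abs_of_pos hp]) n).2
  have hu : ∀ n, |(branchOrbit σ p n).1| ≤ 2 * |(branchOrbit σ p n).2| := fun n => by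
    rw [abs_of_pos (branchOrbit_snd_pos σ hp n)]
    exact abs_le_of_mem_halfCone (h n)
  have hl : ∀ n, |(branchOrbit σ p n).2| / 4 ≤ sgn (σ n) * (branchOrbit σ p n).1 := fun n =>
    le_of_branch_mem_cone (hs n) (hu n) (hu (n + 1))
  have hside : ∀ n, side (branchOrbit σ p n) = σ n := fun n => by
    have := abs_pos.2 (branchOrbit_snd_pos σ hp n).ne'
    exact side_eq (by linarith [hl n])
  have heq : ∀ n, branchOrbit σ p n = planeStep^[n] p := fun n => by
    induction n with
    | zero => rfl
    | succ n ih =>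
      rw [Function.iterate_succ_apply', ← ih, planeStep, hside n, branchOrbit]
  refine ⟨fun n => ?_, funext fun n => by rw [itinerary, ← heq, hside]⟩
  rw [← heq]
  refine ⟨hs n, hu n, ?_⟩
  have h1 := hl n
  rw [← hside n, sgn_side_mul] at h1
  linarith

/-- Itinerary and second coordinate of a stable point. -/
noncomputable def stableCode (p : stablePos) : (ℕ → Bool) × Set.Ioo (0 : ℝ) (1 / 100) :=
  (itinerary p, ⟨p.1.2, p.2.2⟩)

/-- Injectivity comes from expansion, surjectivity from the nested intervals. -/
theorem bijective_stableCode : Function.Bijective stableCode := by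
  constructor
  · intro p r h
    obtain ⟨hσ, hq⟩ := Prod.ext_iff.1 h
    have hσ : itinerary p = itinerary r := hσ
    have hq : p.1.2 = r.1.2 := congrArg Subtype.val hq
    have h1 : |r.1.1 - p.1.1| ≤ 0 := by
      refine ge_of_tendsto' tendsto_sixteenth_pow fun n => ?_
      have := abs_sub_le_of_itinerary_eq p.2.1 p.2.2.1 r.2.1 r.2.2.1 (n := n)
        fun k _ => by rw [hσ]
      simpa [hq] using this
    have h2 := abs_nonpos_iff.1 h1
    exact Subtype.ext (Prod.ext (by linarith) hq)
  · rintro ⟨σ, q, hq⟩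
    obtain ⟨u, hu⟩ := exists_branchOrbit_mem σ hq.1 hq.2.le
    obtain ⟨h1, h2⟩ := mem_stableSet_of_branchOrbit (p := (u, q)) hq.1 hq.2.le hu
    exact ⟨⟨(u, q), h1, hq⟩, Prod.ext h2 rfl⟩

theorem continuousOn_iterate (n : ℕ) : ContinuousOn (planeStep^[n]) stableSet := by
  induction n with
  | zero => exact continuousOn_id
  | succ n ih =>
    rw [Function.iterate_succ']
    exact continuousOn_planeStep.comp ih fun p hp => hp n

/-- A stable orbit with `q > 0` never meets `u = 0`, so each of its sides is locally constant. -/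
theorem continuous_stableCode : Continuous stableCode := by
  refine Continuous.prodMk (continuous_pi fun n => ?_) (by fun_prop)
  refine continuous_iff_continuousAt.2 fun p => ?_
  have h1 : Continuous fun r : stablePos => planeStep^[n] r.1 :=
    (continuousOn_iterate n).comp_continuous continuous_subtype_val fun r => r.2.1
  have h2 := h1.continuousAt.eventually
    (eventually_side_eq (iterate_fst_ne_zero p.2.1 p.2.2.1 n))
  exact continuousAt_const.congr (h2.mono fun r hr => hr.symm)

/-- Expansion gives an explicit modulus: agreement of `n` symbols and of `q` up to `ε / 16` bounds
the change in `u` by `8 * (ε / 16) + ε / 2`. -/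
theorem continuous_stableCode_symm :
    Continuous (Equiv.ofBijective stableCode bijective_stableCode).symm := by
  set φ := Equiv.ofBijective stableCode bijective_stableCode
  have hφ : ∀ z, stableCode (φ.symm z) = z := φ.apply_symm_apply
  have hσ : ∀ z, itinerary (φ.symm z) = z.1 := fun z => congrArg Prod.fst (hφ z)
  have hq : ∀ z, (φ.symm z).1.2 = z.2 := fun z => congrArg (fun w => (w.2 : ℝ)) (hφ z)
  refine Continuous.subtype_mk (f := fun z => (φ.symm z).1) ?_ _
  refine Continuous.prodMk ?_ (by simp only [hq]; fun_prop)
  refine continuous_iff_continuousAt.2 fun z => Metric.tendsto_nhds.2 fun ε hε => ?_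
  obtain ⟨n, hn⟩ := (tendsto_sixteenth_pow.eventually (gt_mem_nhds (half_pos hε))).exists
  have h1 : ∀ᶠ w : (ℕ → Bool) × Set.Ioo (0 : ℝ) (1 / 100) in 𝓝 z, ∀ k < n, w.1 k = z.1 k := by
    refine (eventually_all_finite (Set.finite_lt_nat n)).2 fun k _ => ?_
    have : Continuous fun w : (ℕ → Bool) × Set.Ioo (0 : ℝ) (1 / 100) => w.1 k := by fun_prop
    exact this.continuousAt.eventually (p := fun b => b = z.1 k) (by simp [nhds_discrete])
  have h2 : ∀ᶠ w : (ℕ → Bool) × Set.Ioo (0 : ℝ) (1 / 100) in 𝓝 z,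
      dist (w.2 : ℝ) z.2 < ε / 16 := by
    have : Continuous fun w : (ℕ → Bool) × Set.Ioo (0 : ℝ) (1 / 100) => (w.2 : ℝ) := by fun_prop
    exact Metric.tendsto_nhds.1 this.continuousAt _ (by positivity)
  filter_upwards [h1, h2] with w hw1 hw2
  have := abs_sub_le_of_itinerary_eq (φ.symm z).2.1 (φ.symm z).2.2.1 (φ.symm w).2.1
    (φ.symm w).2.2.1 (n := n) fun k hk => by rw [hσ, hσ]; exact hw1 k hk
  rw [hq, hq] at this
  rw [Real.dist_eq] at hw2 ⊢
  linarith

/-- The stable points above the axis form a Cantor set of vertical curves. -/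
noncomputable def stableHomeomorph : stablePos ≃ₜ (ℕ → Bool) × Set.Ioo (0 : ℝ) (1 / 100) where
  toEquiv := Equiv.ofBijective stableCode bijective_stableCode
  continuous_toFun := continuous_stableCode
  continuous_invFun := continuous_stableCode_symm

/-! ### The stable set is null. -/

/-- There are `2 ^ n` initial itineraries, each confining `u` to a set of diameter at most `16 ^
(-n)`; the total `8 ^ (-n)` tends to zero. -/
theorem volume_slice_eq_zero_of_pos {q : ℝ} (hq : 0 < q) :
    volume {u : ℝ | (u, q) ∈ stableSet} = 0 := by
  have key : ∀ n : ℕ, volume {u : ℝ | (u, q) ∈ stableSet} ≤ ENNReal.ofReal ((1 / 8) ^ n) := by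
    intro n
    have hsub : {u : ℝ | (u, q) ∈ stableSet} ⊆ ⋃ w : Fin n → Bool,
        {u : ℝ | (u, q) ∈ stableSet ∧ ∀ k : Fin n, itinerary (u, q) k = w k} :=
      fun u hu => Set.mem_iUnion.2 ⟨fun k => itinerary (u, q) k, hu, fun _ => rfl⟩
    have hdiam : ∀ w : Fin n → Bool,
        volume {u : ℝ | (u, q) ∈ stableSet ∧ ∀ k : Fin n, itinerary (u, q) k = w k} ≤
          ENNReal.ofReal ((1 / 16) ^ n) := by
      refine fun w => (Real.volume_le_diam _).trans (Metric.ediam_le fun u hu v hv => ?_)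
      rw [edist_dist]
      refine ENNReal.ofReal_le_ofReal ?_
      have := abs_sub_le_of_itinerary_eq hv.1 hq hu.1 hq (n := n)
        fun k hk => (hu.2 ⟨k, hk⟩).trans (hv.2 ⟨k, hk⟩).symm
      simpa [Real.dist_eq] using this
    refine (measure_mono hsub).trans ((measure_iUnion_fintype_le _ _).trans
      ((Finset.sum_le_sum fun w _ => hdiam w).trans ?_))
    rw [Finset.sum_const, Finset.card_univ, Fintype.card_fun, Fintype.card_bool, Fintype.card_fin,
      nsmul_eq_mul, ← ENNReal.ofReal_natCast, ← ENNReal.ofReal_mul (by positivity)]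
    refine ENNReal.ofReal_le_ofReal (le_of_eq ?_)
    push_cast
    rw [← mul_pow]
    norm_num
  have hlim : Tendsto (fun n : ℕ => ENNReal.ofReal ((1 / 8 : ℝ) ^ n)) atTop (𝓝 0) := by
    rw [← ENNReal.ofReal_zero]
    exact ENNReal.tendsto_ofReal
      (tendsto_pow_atTop_nhds_zero_of_lt_one (by norm_num) (by norm_num))
  exact le_antisymm (ge_of_tendsto' hlim key) bot_le

theorem planeStep_neg_snd (p : ℝ × ℝ) :
    planeStep (p.1, -p.2) = ((planeStep p).1, -(planeStep p).2) := by
  have h : gap (p.1, -p.2) = gap p := gap_neg_right _ _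
  simp only [planeStep, branch, side, h, neg_mul]

theorem neg_snd_mem_stableSet {p : ℝ × ℝ} (h : p ∈ stableSet) : (p.1, -p.2) ∈ stableSet := by
  have key : ∀ n, planeStep^[n] (p.1, -p.2) = ((planeStep^[n] p).1, -(planeStep^[n] p).2) := by
    intro n
    induction n with
    | zero => rfl
    | succ n ih => rw [Function.iterate_succ_apply', ih, planeStep_neg_snd,
        Function.iterate_succ_apply']
  intro n
  rw [key]
  simpa [cone] using h n

theorem volume_slice_eq_zero (q : ℝ) : volume {u : ℝ | (u, q) ∈ stableSet} = 0 := by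
  rcases lt_trichotomy q 0 with hq | rfl | hq
  · refine measure_mono_null (fun u hu => ?_) (volume_slice_eq_zero_of_pos (neg_pos.2 hq))
    exact neg_snd_mem_stableSet hu
  · refine measure_mono_null (t := {0}) (fun u hu => ?_) (by simp)
    simpa using (hu 0).2.1
  · exact volume_slice_eq_zero_of_pos hq

theorem volume_stableSet : volume stableSet = 0 := by
  rw [Measure.volume_eq_prod, Measure.prod_apply_symm isClosed_stableSet.measurableSet]
  have : ∀ q : ℝ, volume ((fun u : ℝ => (u, q)) ⁻¹' stableSet) = 0 := volume_slice_eq_zero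
  simp [this]

/-! ### The explicit bidiagonal chart. -/

theorem mem_spectrum_iff_det {n : ℕ} {M : Matrix (Fin n) (Fin n) ℝ} {s : ℝ} :
    s ∈ spectrum ℝ M ↔ (s • (1 : Matrix (Fin n) (Fin n) ℝ) - M).det = 0 := by
  rw [spectrum.mem_iff, Matrix.isUnit_iff_isUnit_det, isUnit_iff_ne_zero, not_not,
    Algebra.algebraMap_eq_smul_one]

/-- The squared norm of the first column of the unipotent factor. -/
noncomputable def normSqFirst (x y : ℝ) : ℝ := 1 + x ^ 2 / 4 + x ^ 2 * y ^ 2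

/-- The squared norm of the last row of the inverse of the unipotent factor. -/
noncomputable def normSqLast (x y : ℝ) : ℝ := 1 + y ^ 2 + x ^ 2 * y ^ 2 / 4

theorem normSqFirst_pos (x y : ℝ) : 0 < normSqFirst x y := by unfold normSqFirst; positivity

theorem normSqLast_pos (x y : ℝ) : 0 < normSqLast x y := by unfold normSqLast; positivity

/-- Reciprocal of the norm of the first column of the unipotent factor. -/
noncomputable def invNormFirst (x y : ℝ) : ℝ := (√(normSqFirst x y))⁻¹

/-- Reciprocal of the norm of the last row of the inverse of the unipotent factor. -/
noncomputable def invNormLast (x y : ℝ) : ℝ := (√(normSqLast x y))⁻¹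

theorem invNormFirst_pos (x y : ℝ) : 0 < invNormFirst x y :=
  inv_pos.2 (sqrt_pos.2 (normSqFirst_pos x y))

theorem invNormLast_pos (x y : ℝ) : 0 < invNormLast x y :=
  inv_pos.2 (sqrt_pos.2 (normSqLast_pos x y))

theorem invNormFirst_sq (x y : ℝ) : invNormFirst x y ^ 2 * (1 + x ^ 2 / 4 + x ^ 2 * y ^ 2) = 1 := by
  rw [invNormFirst, inv_pow, sq_sqrt (normSqFirst_pos x y).le]
  exact inv_mul_cancel₀ (normSqFirst_pos x y).ne'

theorem invNormLast_sq (x y : ℝ) : invNormLast x y ^ 2 * (1 + y ^ 2 + x ^ 2 * y ^ 2 / 4) = 1 := by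
  rw [invNormLast, inv_pow, sq_sqrt (normSqLast_pos x y).le]
  exact inv_mul_cancel₀ (normSqLast_pos x y).ne'

theorem eq_invNormFirst {x y r : ℝ} (hr : 0 < r) (h : r ^ 2 * (1 + x ^ 2 / 4 + x ^ 2 * y ^ 2) = 1) :
    r = invNormFirst x y := by
  have h1 : r ^ 2 = invNormFirst x y ^ 2 :=
    mul_right_cancel₀ (normSqFirst_pos x y).ne' (h.trans (invNormFirst_sq x y).symm)
  exact (pow_left_inj₀ hr.le (invNormFirst_pos x y).le two_ne_zero).1 h1

theorem eq_invNormLast {x y r : ℝ} (hr : 0 < r) (h : r ^ 2 * (1 + y ^ 2 + x ^ 2 * y ^ 2 / 4) = 1) :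
    r = invNormLast x y := by
  have h1 : r ^ 2 = invNormLast x y ^ 2 :=
    mul_right_cancel₀ (normSqLast_pos x y).ne' (h.trans (invNormLast_sq x y).symm)
  exact (pow_left_inj₀ hr.le (invNormLast_pos x y).le two_ne_zero).1 h1

/-- The unipotent factor of the matrix with bidiagonal coordinates `(x, y)`. -/
noncomputable def chartL (x y : ℝ) : Mat3 := !![1, 0, 0; -x / 2, 1, 0; -(x * y), y, 1]

/-- The inverse of `chartL`. -/
noncomputable def chartLInv (x y : ℝ) : Mat3 := !![1, 0, 0; x / 2, 1, 0; x * y / 2, -y, 1]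

/-- The orthogonal factor of the matrix with bidiagonal coordinates `(x, y)`. -/
noncomputable def chartQ (x y : ℝ) : Mat3 :=
  let a := invNormFirst x y
  let b := invNormLast x y
  -- The outer columns are the normalized first column of `chartL` and last row of `chartLInv`; the
  -- middle column is the cross product of the third with the first.
  !![a, (x * y ^ 2 + x / 2) * (a * b), x * y / 2 * b;
     -x / 2 * a, (1 + x ^ 2 * y ^ 2 / 2) * (a * b), -y * b;
     -(x * y) * a, (y - x ^ 2 * y / 4) * (a * b), b]

/-- The triangular factor of the matrix with bidiagonal coordinates `(x, y)`. -/
noncomputable def chartU (x y : ℝ) : Mat3 :=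
  let a := invNormFirst x y
  let b := invNormLast x y
  !![a, (x * y ^ 2 + x / 2) * (a * b), x * y / 2 * b;
     0, normSqFirst x y * (a * b), (x ^ 2 * y / 4 - y) * b;
     0, 0, normSqLast x y * b]

/-- The matrix with bidiagonal coordinates `(x, y)`. -/
noncomputable def chartT (x y : ℝ) : Mat3 := (chartQ x y).transpose * Lam * chartQ x y

theorem chartL_mul_chartLInv (x y : ℝ) : chartL x y * chartLInv x y = 1 := by
  ext i j
  fin_cases i <;> fin_cases j <;>
    simp [chartL, chartLInv, Matrix.mul_apply, Fin.sum_univ_three] <;> ring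

theorem chartLInv_mul_chartL (x y : ℝ) : chartLInv x y * chartL x y = 1 :=
  mul_eq_one_comm.1 (chartL_mul_chartLInv x y)

theorem chartQ_orthogonal (x y : ℝ) : (chartQ x y).transpose * chartQ x y = 1 := by
  have ha := invNormFirst_sq x y
  have hb := invNormLast_sq x y
  ext i j
  fin_cases i <;> fin_cases j <;>
    simp [chartQ, Matrix.mul_apply, Fin.sum_univ_three] <;>
    generalize invNormFirst x y = a at * <;> generalize invNormLast x y = b at *
  · linear_combination ha
  · ring
  · ring
  · ring
  · linear_combination b ^ 2 * (1 + y ^ 2 + x ^ 2 * y ^ 2 / 4) * ha + hb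
  · ring
  · ring
  · ring
  · linear_combination hb

theorem chartQ_eq (x y : ℝ) : chartQ x y = chartL x y * chartU x y := by
  ext i j
  fin_cases i <;> fin_cases j <;>
    simp [chartQ, chartL, chartU, Matrix.mul_apply, Fin.sum_univ_three, normSqFirst, normSqLast] <;>
    ring

theorem Lam_mul_chartL (x y : ℝ) : Lam * chartL x y = chartL x y * bidiag x y := by
  ext i j
  fin_cases i <;> fin_cases j <;>
    simp [Lam, chartL, bidiag, Matrix.mul_apply, Fin.sum_univ_three] <;> ring

theorem hasCoords_chartT (x y : ℝ) : HasCoords (chartT x y) x y := by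
  refine ⟨chartQ x y, chartL x y, chartU x y, chartQ_orthogonal x y, rfl, chartQ_eq x y,
    ?_, ?_, ?_, ?_, ?_⟩
  · intro i j h
    fin_cases i <;> fin_cases j <;> simp_all [chartL]
  · intro i
    fin_cases i <;> simp [chartL]
  · intro i j h
    fin_cases i <;> fin_cases j <;> simp_all [chartU]
  · have ha := invNormFirst_pos x y
    have hb := invNormLast_pos x y
    have ha' := normSqFirst_pos x y
    have hb' := normSqLast_pos x y
    intro i
    fin_cases i <;> simp [chartU] <;> positivity
  · rw [Matrix.inv_eq_left_inv (chartLInv_mul_chartL x y), mul_assoc, Lam_mul_chartL, ← mul_assoc,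
      chartLInv_mul_chartL, one_mul]

/-- Orthogonal matrices diagonalizing a matrix in the chart domain are given by the chart. -/
theorem eq_chartQ {Q : Mat3} (hQ : Q.transpose * Q = 1) (hdet : Q.det = 1) (h0 : 0 < Q 0 0)
    (h2 : 0 < Q 2 2) (hT : (Q.transpose * Lam * Q) 0 2 = 0) :
    Q = chartQ (-2 * Q 1 0 / Q 0 0) (-Q 1 2 / Q 2 2) := by
  obtain ⟨x, hx⟩ : ∃ x, -2 * Q 1 0 / Q 0 0 = x := ⟨_, rfl⟩
  obtain ⟨y, hy⟩ : ∃ y, -Q 1 2 / Q 2 2 = y := ⟨_, rfl⟩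
  rw [hx, hy]
  have e10 : Q 1 0 = -x / 2 * Q 0 0 := by rw [← hx]; field_simp
  have e12 : Q 1 2 = -y * Q 2 2 := by rw [← hy]; field_simp
  have e02 : Q 0 2 = x * y / 2 * Q 2 2 := by
    simp [Lam, Matrix.mul_apply, Fin.sum_univ_three, e10, e12] at hT
    refine mul_left_cancel₀ h0.ne' ?_
    linear_combination hT
  have h := fun i j => congrFun (congrFun hQ i) j
  simp only [Matrix.mul_apply, Fin.sum_univ_three, Matrix.transpose_apply] at h
  have e20 : Q 2 0 = -(x * y) * Q 0 0 := by
    have := h 0 2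
    simp [e10, e12, e02] at this
    refine mul_right_cancel₀ h2.ne' ?_
    linear_combination this
  have ea : Q 0 0 = invNormFirst x y := by
    refine eq_invNormFirst h0 ?_
    have := h 0 0
    simp [e10, e20] at this
    linear_combination this
  have eb : Q 2 2 = invNormLast x y := by
    refine eq_invNormLast h2 ?_
    have := h 2 2
    simp [e12, e02] at this
    linear_combination this
  -- For an orthogonal matrix of determinant one, this expresses the middle column as the cross
  -- product of the outer ones.
  have hadj : Q.adjugate = Q.transpose := by
    have h1 : Q * Q.transpose = 1 := mul_eq_one_comm.1 hQ
    calc Q.adjugate = Q.adjugate * (Q * Q.transpose) := by rw [h1, mul_one]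
      _ = Q.transpose := by rw [← mul_assoc, Matrix.adjugate_mul, hdet, one_smul, one_mul]
  have hc := fun j => congrFun (congrFun hadj 1) j
  simp only [Matrix.adjugate_fin_three, Matrix.transpose_apply] at hc
  have c0 := hc 0
  have c1 := hc 1
  have c2 := hc 2
  simp [e10, e12, e02, e20, ea, eb] at c0 c1 c2
  ext i j
  fin_cases i <;> fin_cases j <;>
    simp [chartQ, e10, e12, e02, e20, ea, eb]
  · rw [← c0]; ring
  · rw [← c1]; ring
  · rw [← c2]; ring

theorem chartT_zero_two (x y : ℝ) : chartT x y 0 2 = 0 := by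
  simp [chartT, chartQ, Lam, Matrix.mul_apply, Fin.sum_univ_three]
  ring

/-- The intertwining relation `Λ L = L B` determines the unipotent factor, since the eigenvalues are
distinct. Positivity of `U` gives determinant one and positive corner entries of `Q`, so `eq_chartQ`
applies. -/
theorem eq_chartT_of_hasCoords {T : Mat3} {x y : ℝ} (h : HasCoords T x y) : T = chartT x y := by
  obtain ⟨Q, L, U, hQ, rfl, hQLU, hL0, hL1, hU0, hU1, hB⟩ := h
  have hdetL : L.det = 1 := by
    rw [Matrix.det_of_isLowerTriangular L hL0]
    simp [hL1]
  have hLL : Lam * L = L * bidiag x y := by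
    rw [← hB, ← mul_assoc, ← mul_assoc, Matrix.mul_nonsing_inv _ (by simp [hdetL]), one_mul]
  have l01 := hL0 0 1 (by decide)
  have l02 := hL0 0 2 (by decide)
  have l12 := hL0 1 2 (by decide)
  have hent := fun i j => congrFun (congrFun hLL i) j
  have e1 := hent 1 0
  have e2 := hent 2 0
  have e3 := hent 2 1
  simp [Lam, bidiag, Matrix.mul_apply, Fin.sum_univ_three, hL1, l01, l12] at e1 e2 e3
  have hLeq : L = chartL x y := by
    have e10 : L 1 0 = -x / 2 := by linarith
    have e21 : L 2 1 = y := by linarith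
    rw [e21] at e2
    have e20 : L 2 0 = -(x * y) := by linarith
    ext i j
    fin_cases i <;> fin_cases j <;> simp [chartL, hL1, l01, l02, l12, e10, e20, e21]
  subst hLeq
  have u10 := hU0 1 0 (by decide)
  have u20 := hU0 2 0 (by decide)
  have u21 := hU0 2 1 (by decide)
  have hQU : U * Q.transpose = chartLInv x y := by
    have h1 : (Q.transpose * chartL x y) * U = 1 := by rw [mul_assoc, ← hQLU, hQ]
    have h2 := mul_eq_one_comm.1 h1
    rw [← mul_assoc] at h2
    calc U * Q.transpose = U * Q.transpose * (chartL x y * chartLInv x y) := by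
          rw [chartL_mul_chartLInv, mul_one]
      _ = chartLInv x y := by rw [← mul_assoc, h2, one_mul]
  have hdet : Q.det = 1 := by
    have h1 : Q.det * Q.det = 1 := by
      have := congrArg Matrix.det hQ
      rwa [Matrix.det_mul, Matrix.det_transpose, Matrix.det_one] at this
    have h2 : 0 < Q.det := by
      rw [hQLU, Matrix.det_mul, hdetL, one_mul, Matrix.det_of_isUpperTriangular
        (fun i j hij => hU0 i j hij)]
      exact Finset.prod_pos fun i _ => hU1 i
    nlinarith
  have hrow := fun j => congrFun (congrFun hQU 2) j
  have hcol := fun i => congrFun (congrFun hQLU i) 0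
  simp only [Matrix.mul_apply, Fin.sum_univ_three, Matrix.transpose_apply, u20, u21, u10]
    at hrow hcol
  have r0 := hrow 0
  have r1 := hrow 1
  have r2 := hrow 2
  have c0 := hcol 0
  have c1 := hcol 1
  simp [chartLInv, chartL] at r0 r1 r2 c0 c1
  have p0 := hU1 0
  have p2 := hU1 2
  have q22 : 0 < Q 2 2 := by
    by_contra! hneg
    nlinarith
  have e12 : -Q 1 2 / Q 2 2 = y := by
    rw [div_eq_iff q22.ne']
    refine mul_left_cancel₀ p2.ne' ?_
    linear_combination -r1 - y * r2
  have e10 : -2 * Q 1 0 / Q 0 0 = x := by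
    rw [div_eq_iff (by rw [c0]; exact p0.ne'), c0, c1]
    ring
  have key := eq_chartQ hQ hdet (by rwa [c0]) q22 (by
    have e02 : Q 0 2 = x * y / 2 * Q 2 2 := by
      refine mul_left_cancel₀ p2.ne' ?_
      linear_combination r0 - x * y / 2 * r2
    have e12' : Q 1 2 = -y * Q 2 2 := by rw [← e12]; field_simp
    simp only [Lam, Matrix.mul_apply, Fin.sum_univ_three, Matrix.transpose_apply]
    simp [c0, c1, e02, e12']
    ring)
  rw [e10, e12] at key
  rw [chartT, ← key]

/-! ### Diagonalization and the inverse of the chart. -/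

theorem exists_unit_eigenvector {T : Mat3} {s : ℝ} (h : s ∈ spectrum ℝ T) :
    ∃ v : Fin 3 → ℝ, v ⬝ᵥ v = 1 ∧ T.mulVec v = s • v := by
  obtain ⟨v, hv, hTv⟩ := Matrix.exists_mulVec_eq_zero_iff.2 (mem_spectrum_iff_det.1 h)
  have hpos : 0 < v ⬝ᵥ v := by
    refine lt_of_le_of_ne (Finset.sum_nonneg fun i _ => mul_self_nonneg _) fun h0 => hv ?_
    exact dotProduct_self_eq_zero.1 h0.symm
  have hT : T.mulVec v = s • v := by
    rw [Matrix.sub_mulVec, Matrix.smul_mulVec, Matrix.one_mulVec, sub_eq_zero] at hTv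
    exact hTv.symm
  refine ⟨(√(v ⬝ᵥ v))⁻¹ • v, ?_, ?_⟩
  · rw [smul_dotProduct, dotProduct_smul, smul_eq_mul, smul_eq_mul, ← mul_assoc, ← mul_inv,
      mul_self_sqrt hpos.le, inv_mul_cancel₀ hpos.ne']
  · rw [Matrix.mulVec_smul, hT, smul_comm]

theorem dotProduct_eq_zero_of_eigenvectors {T : Mat3} (hT : T.IsSymm) {s t : ℝ} (hst : s ≠ t)
    {v w : Fin 3 → ℝ} (hv : T.mulVec v = s • v) (hw : T.mulVec w = t • w) : v ⬝ᵥ w = 0 := by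
  have h1 : v ⬝ᵥ T.mulVec w = T.mulVec v ⬝ᵥ w := by
    rw [Matrix.dotProduct_mulVec, ← Matrix.mulVec_transpose, hT.eq]
  rw [hv, hw, smul_dotProduct, dotProduct_smul, smul_eq_mul, smul_eq_mul] at h1
  have h2 : (t - s) * (v ⬝ᵥ w) = 0 := by linear_combination h1
  exact (mul_eq_zero.1 h2).resolve_left (sub_ne_zero.2 hst.symm)

/-- Diagonalization of a matrix with spectrum `{-1, 0, 1}`. -/
theorem exists_orthogonal_of_isospectral {T : Mat3} (hT : T ∈ isospectral) :
    ∃ Q : Mat3, Q.transpose * Q = 1 ∧ T = Q.transpose * Lam * Q := by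
  obtain ⟨hs, -, hspec⟩ := hT
  obtain ⟨v1, n1, e1⟩ := exists_unit_eigenvector (T := T) (s := 1) (by simp [hspec])
  obtain ⟨v2, n2, e2⟩ := exists_unit_eigenvector (T := T) (s := -1) (by simp [hspec])
  obtain ⟨v3, n3, e3⟩ := exists_unit_eigenvector (T := T) (s := 0) (by simp [hspec])
  have o12 := dotProduct_eq_zero_of_eigenvectors hs (by norm_num) e1 e2
  have o13 := dotProduct_eq_zero_of_eigenvectors hs (by norm_num) e1 e3
  have o23 := dotProduct_eq_zero_of_eigenvectors hs (by norm_num) e2 e3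
  have hQ : (Matrix.of ![v1, v2, v3]) * (Matrix.of ![v1, v2, v3]).transpose = 1 := by
    ext i j
    have h : ((Matrix.of ![v1, v2, v3]) * (Matrix.of ![v1, v2, v3]).transpose) i j =
        ![v1, v2, v3] i ⬝ᵥ ![v1, v2, v3] j := rfl
    rw [h]
    fin_cases i <;> fin_cases j <;>
      simp [n1, n2, n3, o12, o13, o23, dotProduct_comm v2 v1, dotProduct_comm v3]
  have hQT : T * (Matrix.of ![v1, v2, v3]).transpose =
      (Matrix.of ![v1, v2, v3]).transpose * Lam := by
    ext i j
    have h : (T * (Matrix.of ![v1, v2, v3]).transpose) i j = T.mulVec (![v1, v2, v3] j) i := rfl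
    rw [h]
    fin_cases j <;> simp [e1, e2, e3, Lam, Matrix.mul_apply, Fin.sum_univ_three]
  refine ⟨_, mul_eq_one_comm.1 hQ, ?_⟩
  rw [← hQT, mul_assoc, mul_eq_one_comm.1 hQ, mul_one]

/-- Twice the squared first entry of the unit eigenvector for the eigenvalue `1`. -/
noncomputable def sqFirst (T : Mat3) : ℝ := ((T * T) 0 0 + T 0 0) / 2

/-- The squared last entry of the unit eigenvector for the eigenvalue `0`. -/
def sqLast (T : Mat3) : ℝ := 1 - (T * T) 2 2

theorem conj_mul_self {Q : Mat3} (hQ : Q.transpose * Q = 1) :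
    Q.transpose * Lam * Q * (Q.transpose * Lam * Q) = Q.transpose * (Lam * Lam) * Q := by
  rw [show Q.transpose * Lam * Q * (Q.transpose * Lam * Q) =
    Q.transpose * Lam * (Q * Q.transpose) * Lam * Q by simp only [mul_assoc],
    mul_eq_one_comm.1 hQ, mul_one]
  simp only [mul_assoc]

/-- `(T² + T) / 2` is the spectral projection for the eigenvalue `1`, and `1 - T²`, used in
`sqLast`, the one for `0`. Squared eigenvector entries are thus polynomial in `T`. -/
theorem sqFirst_conj {Q : Mat3} (hQ : Q.transpose * Q = 1) :
    sqFirst (Q.transpose * Lam * Q) = Q 0 0 ^ 2 := by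
  rw [sqFirst, conj_mul_self hQ]
  simp [Matrix.mul_apply, Fin.sum_univ_three, Lam]
  ring

theorem sqLast_conj {Q : Mat3} (hQ : Q.transpose * Q = 1) :
    sqLast (Q.transpose * Lam * Q) = Q 2 2 ^ 2 := by
  have h2 := congrFun (congrFun hQ 2) 2
  rw [sqLast, conj_mul_self hQ]
  simp [Matrix.mul_apply, Fin.sum_univ_three, Lam] at h2 ⊢
  linear_combination -h2

theorem sign_conj (e : Fin 3 → ℝ) (he : ∀ i, e i * e i = 1) (Q : Mat3) :
    (Matrix.diagonal e * Q).transpose * (Matrix.diagonal e * Q) = Q.transpose * Q ∧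
    (Matrix.diagonal e * Q).transpose * Lam * (Matrix.diagonal e * Q) =
      Q.transpose * Lam * Q := by
  have h1 : Matrix.diagonal e * Matrix.diagonal e = 1 := by
    rw [Matrix.diagonal_mul_diagonal, ← Matrix.diagonal_one]
    exact congrArg _ (funext he)
  have h2 : Matrix.diagonal e * Lam * Matrix.diagonal e = Lam := by
    ext i j
    fin_cases i <;> fin_cases j <;> simp [Lam, he]
  rw [Matrix.transpose_mul, Matrix.diagonal_transpose]
  constructor
  · rw [show Q.transpose * Matrix.diagonal e * (Matrix.diagonal e * Q) =
      Q.transpose * (Matrix.diagonal e * Matrix.diagonal e) * Q by simp only [mul_assoc], h1,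
      mul_one]
  · rw [show Q.transpose * Matrix.diagonal e * Lam * (Matrix.diagonal e * Q) =
      Q.transpose * (Matrix.diagonal e * Lam * Matrix.diagonal e) * Q by simp only [mul_assoc], h2]

theorem exists_sign_mul_pos {r : ℝ} (hr : r ≠ 0) : ∃ e : ℝ, e * e = 1 ∧ 0 < e * r := by
  rcases hr.lt_or_gt with h | h
  · exact ⟨-1, by norm_num, by linarith⟩
  · exact ⟨1, by norm_num, by linarith⟩

theorem exists_eq_chartT {T : Mat3} (hT : T ∈ isospectral) (h0 : 0 < sqFirst T)
    (h2 : 0 < sqLast T) : ∃ x y, T = chartT x y := by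
  obtain ⟨Q, hQ, rfl⟩ := exists_orthogonal_of_isospectral hT
  rw [sqFirst_conj hQ] at h0
  rw [sqLast_conj hQ] at h2
  obtain ⟨e0, he0, hp0⟩ := exists_sign_mul_pos (r := Q 0 0) (by rintro h; simp [h] at h0)
  obtain ⟨e2, he2, hp2⟩ := exists_sign_mul_pos (r := Q 2 2) (by rintro h; simp [h] at h2)
  have hd : Q.det * Q.det = 1 := by
    have := congrArg Matrix.det hQ
    rwa [Matrix.det_mul, Matrix.det_transpose, Matrix.det_one] at this
  -- The eigenvectors are free up to sign: the outer signs make the corner entries positive, and the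
  -- middle one makes the determinant equal to one.
  set e : Fin 3 → ℝ := ![e0, e0 * e2 * Q.det, e2]
  have he : ∀ i, e i * e i = 1 := by
    intro i
    fin_cases i
    · exact he0
    · change (e0 * e2 * Q.det) * (e0 * e2 * Q.det) = 1
      linear_combination e2 * e2 * (Q.det * Q.det) * he0 + (Q.det * Q.det) * he2 + hd
    · exact he2
  obtain ⟨k1, k2⟩ := sign_conj e he Q
  refine ⟨-2 * (Matrix.diagonal e * Q) 1 0 / (Matrix.diagonal e * Q) 0 0,
    -(Matrix.diagonal e * Q) 1 2 / (Matrix.diagonal e * Q) 2 2, k2.symm.trans ?_⟩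
  rw [chartT, ← eq_chartQ (k1.trans hQ)]
  · rw [Matrix.det_mul, Matrix.det_diagonal, Fin.prod_univ_three]
    change e0 * (e0 * e2 * Q.det) * e2 * Q.det = 1
    linear_combination e2 * e2 * (Q.det * Q.det) * he0 + (Q.det * Q.det) * he2 + hd
  · rw [Matrix.diagonal_mul]; exact hp0
  · rw [Matrix.diagonal_mul]; exact hp2
  · rw [k2]; exact hT.2.1

theorem isSymm_chartT (x y : ℝ) : (chartT x y).IsSymm := by
  have : Lam.transpose = Lam := by
    ext i j
    fin_cases i <;> fin_cases j <;> simp [Lam]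
  rw [Matrix.IsSymm, chartT, Matrix.transpose_mul, Matrix.transpose_mul, Matrix.transpose_transpose,
    this, mul_assoc]

theorem chartQ_mul_transpose (x y : ℝ) : chartQ x y * (chartQ x y).transpose = 1 :=
  mul_eq_one_comm.1 (chartQ_orthogonal x y)

theorem smul_one_sub_chartT (x y s : ℝ) :
    s • (1 : Mat3) - chartT x y = (chartQ x y).transpose * (s • (1 : Mat3) - Lam) * chartQ x y := by
  rw [mul_sub, sub_mul, chartT, Matrix.mul_smul, mul_one, Matrix.smul_mul, chartQ_orthogonal]

theorem chartT_mem_isospectral (x y : ℝ) : chartT x y ∈ isospectral := by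
  refine ⟨isSymm_chartT x y, chartT_zero_two x y, ?_⟩
  ext s
  rw [mem_spectrum_iff_det, smul_one_sub_chartT, Matrix.det_mul, Matrix.det_mul, mul_right_comm,
    ← Matrix.det_mul, chartQ_orthogonal, Matrix.det_one, one_mul]
  have : (s • (1 : Mat3) - Lam).det = (s - 1) * (s + 1) * s := by
    rw [Matrix.det_fin_three]
    simp [Lam]
  rw [this, mul_eq_zero, mul_eq_zero, sub_eq_zero, add_eq_zero_iff_eq_neg]
  simp only [Set.mem_insert_iff, Set.mem_singleton_iff]
  tauto

theorem sqFirst_chartT (x y : ℝ) : sqFirst (chartT x y) = invNormFirst x y ^ 2 := by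
  rw [chartT, sqFirst_conj (chartQ_orthogonal x y)]
  simp [chartQ]

theorem sqLast_chartT (x y : ℝ) : sqLast (chartT x y) = invNormLast x y ^ 2 := by
  rw [chartT, sqLast_conj (chartQ_orthogonal x y)]
  simp [chartQ]

/-- Together with `chartT_two_one`, this recovers `x` and `y` from the subdiagonal entries, giving a
continuous formula for the inverse chart. -/
theorem chartT_one_zero (x y : ℝ) :
    chartT x y 1 0 * invNormLast x y = x * invNormFirst x y ^ 2 := by
  have h := invNormLast_sq x y
  simp [chartT, chartQ, Lam, Matrix.mul_apply, Fin.sum_univ_three]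
  linear_combination x * invNormFirst x y ^ 2 * h

theorem chartT_two_one (x y : ℝ) :
    chartT x y 2 1 * invNormFirst x y = y * invNormLast x y ^ 2 := by
  have h := invNormFirst_sq x y
  simp [chartT, chartQ, Lam, Matrix.mul_apply, Fin.sum_univ_three]
  linear_combination y * invNormLast x y ^ 2 * h

/-- The first bidiagonal coordinate. -/
noncomputable def coordX (T : Mat3) : ℝ := T 1 0 * √(sqLast T) / sqFirst T

/-- The second bidiagonal coordinate. -/
noncomputable def coordY (T : Mat3) : ℝ := T 2 1 * √(sqFirst T) / sqLast T

theorem coordX_chartT (x y : ℝ) : coordX (chartT x y) = x := by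
  have ha := invNormFirst_pos x y
  have hb := invNormLast_pos x y
  rw [coordX, sqFirst_chartT, sqLast_chartT, sqrt_sq hb.le, chartT_one_zero]
  field_simp

theorem coordY_chartT (x y : ℝ) : coordY (chartT x y) = y := by
  have ha := invNormFirst_pos x y
  have hb := invNormLast_pos x y
  rw [coordY, sqFirst_chartT, sqLast_chartT, sqrt_sq ha.le, chartT_two_one]
  field_simp

theorem hasCoords_chartT_iff {x y x' y' : ℝ} :
    HasCoords (chartT x y) x' y' ↔ x' = x ∧ y' = y := by
  constructor
  · intro h
    have h1 := eq_chartT_of_hasCoords h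
    have h2 := congrArg coordX h1
    have h3 := congrArg coordY h1
    rw [coordX_chartT, coordX_chartT] at h2
    rw [coordY_chartT, coordY_chartT] at h3
    exact ⟨h2.symm, h3.symm⟩
  · rintro ⟨rfl, rfl⟩
    exact hasCoords_chartT _ _

/-! ### Logarithmic coordinates on matrices. -/

/-- The chart in logarithmic coordinates `u = log (x / 2)`, `q = √(2 x) y`. -/
noncomputable def logChart (p : ℝ × ℝ) : Mat3 :=
  chartT (2 * exp p.1) (p.2 / 2 * exp (-p.1 / 2))

/-- The logarithmic coordinates. -/
noncomputable def logCoord (T : Mat3) : ℝ × ℝ :=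
  (log (coordX T / 2), √(2 * coordX T) * coordY T)

/-- The domain of the logarithmic coordinates, within the isospectral manifold. -/
def logDomain : Set Mat3 := {T | 0 < sqFirst T ∧ 0 < sqLast T ∧ 0 < T 1 0}

theorem continuous_sqFirst : Continuous sqFirst := by unfold sqFirst; fun_prop

theorem continuous_sqLast : Continuous sqLast := by unfold sqLast; fun_prop

theorem isOpen_logDomain : IsOpen logDomain := by
  have h1 : IsOpen {T : Mat3 | 0 < sqFirst T} := isOpen_lt continuous_const continuous_sqFirst
  have h2 : IsOpen {T : Mat3 | 0 < sqLast T} := isOpen_lt continuous_const continuous_sqLast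
  have h3 : IsOpen {T : Mat3 | 0 < T 1 0} := isOpen_lt continuous_const (by fun_prop)
  exact h1.inter (h2.inter h3)

theorem coordX_pos {T : Mat3} (h : T ∈ logDomain) : 0 < coordX T :=
  div_pos (mul_pos h.2.2 (sqrt_pos.2 h.2.1)) h.1

theorem continuousOn_coordX : ContinuousOn coordX logDomain := by
  have := continuous_sqFirst
  have := continuous_sqLast
  unfold coordX
  exact ContinuousOn.div (by fun_prop) (by fun_prop) fun T hT => hT.1.ne'

theorem continuousOn_coordY : ContinuousOn coordY logDomain := by
  have := continuous_sqFirst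
  have := continuous_sqLast
  unfold coordY
  exact ContinuousOn.div (by fun_prop) (by fun_prop) fun T hT => hT.2.1.ne'

theorem continuousOn_logCoord : ContinuousOn logCoord logDomain := by
  have h1 := continuousOn_coordX
  have h2 := continuousOn_coordY
  refine ContinuousOn.prodMk (ContinuousOn.log (by fun_prop) fun T hT => ?_) ?_
  · have := coordX_pos hT
    positivity
  · exact (continuousOn_const.mul h1).sqrt.mul h2

theorem continuous_chartQ : Continuous fun p : ℝ × ℝ => chartQ p.1 p.2 := by
  have h1 : Continuous fun p : ℝ × ℝ => invNormFirst p.1 p.2 := by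
    unfold invNormFirst
    refine Continuous.inv₀ (by unfold normSqFirst; fun_prop) fun p => ?_
    exact (sqrt_pos.2 (normSqFirst_pos _ _)).ne'
  have h2 : Continuous fun p : ℝ × ℝ => invNormLast p.1 p.2 := by
    unfold invNormLast
    refine Continuous.inv₀ (by unfold normSqLast; fun_prop) fun p => ?_
    exact (sqrt_pos.2 (normSqLast_pos _ _)).ne'
  refine continuous_matrix fun i j => ?_
  fin_cases i <;> fin_cases j <;> simp [chartQ] <;> fun_prop

theorem continuous_logChart : Continuous logChart := by
  have h : Continuous fun p : ℝ × ℝ => chartT p.1 p.2 := by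
    have := continuous_chartQ
    unfold chartT
    exact (this.matrix_transpose.matrix_mul continuous_const).matrix_mul this
  exact h.comp (f := fun p : ℝ × ℝ => (2 * exp p.1, p.2 / 2 * exp (-p.1 / 2))) (by fun_prop)

theorem sqrt_four_mul_exp (u : ℝ) : √(2 * (2 * exp u)) = 2 * exp (u / 2) := by
  rw [sqrt_eq_iff_mul_self_eq_of_pos (by positivity),
    show 2 * exp (u / 2) * (2 * exp (u / 2)) = 2 * (2 * (exp (u / 2) * exp (u / 2))) by ring,
    ← exp_add]
  ring_nf

theorem logCoord_logChart (p : ℝ × ℝ) : logCoord (logChart p) = p := by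
  have h1 : exp (p.1 / 2) * exp (-p.1 / 2) = 1 := by rw [← exp_add]; ring_nf; exact exp_zero
  ext
  · simp [logCoord, logChart, coordX_chartT]
  · simp only [logCoord, logChart, coordX_chartT, coordY_chartT, sqrt_four_mul_exp]
    linear_combination p.2 * h1

theorem logChart_mem_logDomain (p : ℝ × ℝ) : logChart p ∈ logDomain := by
  refine ⟨?_, ?_, ?_⟩
  · rw [logChart, sqFirst_chartT]
    exact pow_pos (invNormFirst_pos _ _) 2
  · rw [logChart, sqLast_chartT]
    exact pow_pos (invNormLast_pos _ _) 2
  · have h1 := chartT_one_zero (2 * exp p.1) (p.2 / 2 * exp (-p.1 / 2))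
    have h2 := invNormLast_pos (2 * exp p.1) (p.2 / 2 * exp (-p.1 / 2))
    have h3 := invNormFirst_pos (2 * exp p.1) (p.2 / 2 * exp (-p.1 / 2))
    refine pos_of_mul_pos_left (b := invNormLast (2 * exp p.1) (p.2 / 2 * exp (-p.1 / 2))) ?_ h2.le
    rw [logChart, h1]
    positivity

theorem logChart_logCoord {T : Mat3} (h : T ∈ isospectral) (h' : T ∈ logDomain) :
    logChart (logCoord T) = T := by
  obtain ⟨x, y, rfl⟩ := exists_eq_chartT h h'.1 h'.2.1
  have hx := coordX_pos h'
  rw [coordX_chartT] at hx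
  have h1 : exp (log (x / 2)) = x / 2 := exp_log (by positivity)
  have h2 : √(2 * x) * exp (-log (x / 2) / 2) = 2 := by
    have := sqrt_four_mul_exp (log (x / 2))
    rw [h1, show 2 * (2 * (x / 2)) = 2 * x by ring] at this
    rw [this, mul_assoc, ← exp_add]
    ring_nf
    simp
  simp only [logChart, logCoord, coordX_chartT, coordY_chartT, h1]
  congr 1
  · ring
  · linear_combination y / 2 * h2

theorem hasCoords_logChart_iff {p : ℝ × ℝ} {x y : ℝ} :
    HasCoords (logChart p) x y ↔ x = 2 * exp p.1 ∧ y = p.2 / 2 * exp (-p.1 / 2) :=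
  hasCoords_chartT_iff

theorem logChart_zero : logChart 0 = P₀ := by
  have ha : invNormFirst 2 0 = (√2)⁻¹ := by norm_num [invNormFirst, normSqFirst]
  have hb : invNormLast 2 0 = 1 := by norm_num [invNormLast, normSqLast]
  have h2 : (√2)⁻¹ * (√2)⁻¹ = (1 / 2 : ℝ) := by
    rw [← mul_inv, mul_self_sqrt (by norm_num)]; norm_num
  ext i j
  fin_cases i <;> fin_cases j <;>
    simp [logChart, chartT, chartQ, Lam, P₀, ha, hb, Matrix.mul_apply, Fin.sum_univ_three, h2] <;>
    norm_num

/-! ### The QR step in the chart. -/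

/-- The Gram matrix of `M` determines the triangular factor of `M`. -/
theorem IsQR.triangular_unique {M Q R Q' R' : Mat3} (h : IsQR M Q R) (h' : IsQR M Q' R') :
    R = R' := by
  obtain ⟨hQ, hR, p0, p1, p2, hM⟩ := h
  obtain ⟨hQ', hR', p0', p1', p2', hM'⟩ := h'
  have hG : R.transpose * R = R'.transpose * R' := by
    have e1 : M.transpose * M = R.transpose * R := by
      rw [hM, Matrix.transpose_mul, mul_assoc, ← mul_assoc Q.transpose, hQ, one_mul]
    have e2 : M.transpose * M = R'.transpose * R' := by
      rw [hM', Matrix.transpose_mul, mul_assoc, ← mul_assoc Q'.transpose, hQ', one_mul]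
    rw [← e1, e2]
  have z10 := hR 1 0 (by decide)
  have z20 := hR 2 0 (by decide)
  have z21 := hR 2 1 (by decide)
  have z10' := hR' 1 0 (by decide)
  have z20' := hR' 2 0 (by decide)
  have z21' := hR' 2 1 (by decide)
  have hent := fun i j => congrFun (congrFun hG i) j
  simp only [Matrix.mul_apply, Fin.sum_univ_three, Matrix.transpose_apply] at hent
  have g00 := hent 0 0
  have g01 := hent 0 1
  have g02 := hent 0 2
  have g11 := hent 1 1
  have g12 := hent 1 2
  have g22 := hent 2 2
  simp only [z10, z20, z21, z10', z20', z21', mul_zero, zero_mul, add_zero] at *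
  have r00 : R 0 0 = R' 0 0 := (mul_self_inj p0.le p0'.le).1 g00
  have r01 : R 0 1 = R' 0 1 := mul_left_cancel₀ p0.ne' (by rw [g01, r00])
  have r02 : R 0 2 = R' 0 2 := mul_left_cancel₀ p0.ne' (by rw [g02, r00])
  have r11 : R 1 1 = R' 1 1 := (mul_self_inj p1.le p1'.le).1 (by rw [r01] at g11; linarith)
  have r12 : R 1 2 = R' 1 2 :=
    mul_left_cancel₀ p1.ne' (by rw [r01, r02] at g12; rw [r11] at g12 ⊢; linarith)
  have r22 : R 2 2 = R' 2 2 := (mul_self_inj p2 p2').1 (by rw [r02, r12] at g22; linarith)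
  ext i j
  fin_cases i <;> fin_cases j <;> simp [*]

/-- The result of a step does not depend on the choice of the `QR` factorization. -/
theorem IsQR.conj_unique {T Q R Q' R' : Mat3} {s : ℝ} (hT : T.IsSymm)
    (h : IsQR (T - s • (1 : Mat3)) Q R) (h' : IsQR (T - s • (1 : Mat3)) Q' R') :
    Q.transpose * T * Q = Q'.transpose * T * Q' := by
  obtain rfl := h.triangular_unique h'
  obtain ⟨hQ, hR, p0, p1, p2, hM⟩ := h
  obtain ⟨hQ', -, -, -, -, hM'⟩ := h'
  -- Writing the conjugate as `R P + s` isolates the ambiguity: the first two columns of `P` are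
  -- determined, and the last one enters the corner entry only through `R 2 2 * P 2 2`. Symmetry
  -- supplies the rest of the last column.
  have key : ∀ P : Mat3, P.transpose * P = 1 → T - s • (1 : Mat3) = P * R →
      P.transpose * T * P = R * P + s • (1 : Mat3) := by
    intro P hP hPR
    have : T = P * R + s • (1 : Mat3) := by rw [← hPR]; abel
    rw [this, mul_add, ← mul_assoc, hP, one_mul, add_mul, Matrix.mul_smul, mul_one, Matrix.smul_mul,
      hP]
  have symm : ∀ P : Mat3, (P.transpose * T * P).IsSymm := fun P => by
    rw [Matrix.IsSymm, Matrix.transpose_mul, Matrix.transpose_mul, Matrix.transpose_transpose,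
      hT.eq, mul_assoc]
  have z10 := hR 1 0 (by decide)
  have z20 := hR 2 0 (by decide)
  have z21 := hR 2 1 (by decide)
  have hQR : ∀ i j, (Q * R) i j = (Q' * R) i j := fun i j => by rw [← hM, hM']
  simp only [Matrix.mul_apply, Fin.sum_univ_three] at hQR
  have c0 : ∀ i, Q i 0 = Q' i 0 := fun i => by
    have := hQR i 0
    simp only [z10, z20, mul_zero, add_zero] at this
    exact mul_right_cancel₀ p0.ne' this
  have c1 : ∀ i, Q i 1 = Q' i 1 := fun i => by
    have := hQR i 1
    simp only [z21, c0, mul_zero, add_zero, add_right_inj] at this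
    exact mul_right_cancel₀ p1.ne' this
  have e0 : ∀ i, (Q.transpose * T * Q) i 0 = (Q'.transpose * T * Q') i 0 := fun i => by
    rw [key Q hQ hM, key Q' hQ' hM']
    simp [Matrix.mul_apply, Fin.sum_univ_three, c0]
  have e1 : ∀ i, (Q.transpose * T * Q) i 1 = (Q'.transpose * T * Q') i 1 := fun i => by
    rw [key Q hQ hM, key Q' hQ' hM']
    simp [Matrix.mul_apply, Fin.sum_univ_three, c1]
  have e22 : (Q.transpose * T * Q) 2 2 = (Q'.transpose * T * Q') 2 2 := by
    rw [key Q hQ hM, key Q' hQ' hM']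
    have h2 := hQR 2 2
    simp only [c0, c1, add_right_inj] at h2
    simp only [Matrix.add_apply, Matrix.mul_apply, Fin.sum_univ_three, z20, z21]
    linear_combination h2
  ext i j
  fin_cases j
  · exact e0 i
  · exact e1 i
  · fin_cases i
    · change (Q.transpose * T * Q) 0 2 = (Q'.transpose * T * Q') 0 2
      rw [← (symm Q).apply, e0, (symm Q').apply]
    · change (Q.transpose * T * Q) 1 2 = (Q'.transpose * T * Q') 1 2
      rw [← (symm Q).apply, e1, (symm Q').apply]
    · exact e22

theorem IsShift.unique {T : Mat3} {s s' : ℝ} (h : IsShift T s) (h' : IsShift T s') : s = s' := by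
  by_contra hne
  exact lt_asymm (h.2 s' h'.1 (Ne.symm hne)) (h'.2 s h.1 hne)

/-- The inverse of `chartU`. -/
noncomputable def chartUInv (x y : ℝ) : Mat3 :=
  let a := invNormFirst x y
  let b := invNormLast x y
  !![normSqFirst x y * a, -(x / 2 + x * y ^ 2) * a, -(x * y) * a;
     0, normSqLast x y * (a * b), (y - x ^ 2 * y / 4) * (a * b);
     0, 0, b]

theorem chartQ_transpose_mul_chartL (x y : ℝ) :
    (chartQ x y).transpose * chartL x y = chartUInv x y := by
  ext i j
  fin_cases i <;> fin_cases j <;>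
    simp [chartQ, chartL, chartUInv, Matrix.mul_apply, Fin.sum_univ_three, normSqFirst,
      normSqLast] <;> ring

theorem chartQ_mul_chartUInv (x y : ℝ) : chartQ x y * chartUInv x y = chartL x y := by
  rw [← chartQ_transpose_mul_chartL, ← mul_assoc, chartQ_mul_transpose, one_mul]

/-- A `QR` step with shift `s` in bidiagonal coordinates. -/
theorem exists_isQR_chartT {x y x' y' s : ℝ} (hs : -1 < s) (hs' : s < 1)
    (hx : x' * (1 - s) = x * (1 + s)) (hy : y' * (1 + s) = |s| * y) :
    ∃ Q R, IsQR (chartT x y - s • (1 : Mat3)) Q R ∧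
      Q.transpose * chartT x y * Q = chartT x' y' := by
  -- `Λ - s` is split into a sign matrix `E` commuting with `Λ` and a nonnegative diagonal `D`, as
  -- the sign convention on `R` requires.
  obtain ⟨ε, hε, hεs⟩ : ∃ ε : ℝ, ε * ε = 1 ∧ ε * |s| = -s := by
    rcases le_or_gt 0 s with h | h
    · exact ⟨-1, by norm_num, by rw [abs_of_nonneg h]; ring⟩
    · exact ⟨1, by norm_num, by rw [abs_of_neg h]; ring⟩
  set E : Mat3 := Matrix.diagonal ![1, -1, ε] with hE
  set D : Mat3 := !![1 - s, 0, 0; 0, 1 + s, 0; 0, 0, |s|] with hD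
  have hEE : E * E = 1 := by
    rw [hE, Matrix.diagonal_mul_diagonal, ← Matrix.diagonal_one]
    refine congrArg _ (funext fun i => ?_)
    fin_cases i <;> simp [hε]
  have hELE : E * Lam * E = Lam := by
    ext i j
    fin_cases i <;> fin_cases j <;> simp [hE, Lam]
  have hED : Lam - s • (1 : Mat3) = E * D := by
    ext i j
    fin_cases i <;> fin_cases j <;> simp [hE, hD, Lam, hεs]
    ring
  have hxy : x' * y' * (1 - s) = |s| * (x * y) := by
    have : (1 + s) ≠ 0 := by linarith
    refine mul_right_cancel₀ this ?_
    linear_combination y' * (1 + s) * hx + x * (1 + s) * hy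
  -- Conjugation by `D` rescales the unipotent factor. Stated without inverses, it also covers `s =
  -- 0`, where `D` is singular.
  have hDL : D * chartL x y = chartL x' y' * D := by
    ext i j
    fin_cases i <;> fin_cases j <;> simp [hD, chartL]
    · linear_combination hx / 2
    · linear_combination -hxy
    · linear_combination -hy
  have hEt : E.transpose = E := Matrix.diagonal_transpose _
  have hQQ := chartQ_mul_transpose x y
  -- From `T - s = Qᵀ E D L U = Qᵀ E L' D U` and `L' = Q' U'⁻¹`, the orthogonal factor is `Qᵀ E Q'`
  -- and the triangular one `U'⁻¹ D U`.
  refine ⟨(chartQ x y).transpose * E * chartQ x' y', chartUInv x' y' * D * chartU x y,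
    ⟨?_, ?_, ?_, ?_, ?_, ?_⟩, ?_⟩
  · calc ((chartQ x y).transpose * E * chartQ x' y').transpose *
          ((chartQ x y).transpose * E * chartQ x' y')
        = (chartQ x' y').transpose * (E * (chartQ x y * (chartQ x y).transpose) * E) *
            chartQ x' y' := by
          simp only [Matrix.transpose_mul, Matrix.transpose_transpose, hEt, mul_assoc]
      _ = 1 := by rw [hQQ, mul_one, hEE, mul_one, chartQ_orthogonal]
  · intro i j h
    fin_cases i <;> fin_cases j <;>
      first
        | exact absurd h (by decide)
        | simp [chartUInv, chartU, hD, Matrix.mul_apply, Fin.sum_univ_three]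
  · have h1 := invNormFirst_pos x y
    have h2 := invNormFirst_pos x' y'
    have h3 := normSqFirst_pos x' y'
    have h4 : 0 < 1 - s := by linarith
    simp [chartUInv, chartU, hD, Matrix.mul_apply, Fin.sum_univ_three, -sub_pos]
    generalize 1 - s = d at *
    positivity
  · have h1 := invNormFirst_pos x y
    have h2 := invNormFirst_pos x' y'
    have h1' := invNormLast_pos x y
    have h2' := invNormLast_pos x' y'
    have h3 := normSqLast_pos x' y'
    have h3' := normSqFirst_pos x y
    have h4 : 0 < 1 + s := by linarith
    simp [chartUInv, chartU, hD, Matrix.mul_apply, Fin.sum_univ_three]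
    generalize 1 + s = d at *
    positivity
  · have h1' := invNormLast_pos x y
    have h2' := invNormLast_pos x' y'
    have h3 := normSqLast_pos x y
    simp [chartUInv, chartU, hD, Matrix.mul_apply, Fin.sum_univ_three]
    positivity
  · calc chartT x y - s • (1 : Mat3)
        = (chartQ x y).transpose * (Lam - s • (1 : Mat3)) * chartQ x y := by
          rw [← neg_sub, smul_one_sub_chartT, ← neg_sub Lam, mul_neg, neg_mul, neg_neg]
      _ = (chartQ x y).transpose * E * (D * chartL x y) * chartU x y := by
          rw [hED, chartQ_eq]; simp only [mul_assoc]
      _ = _ := by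
          rw [hDL, ← chartQ_mul_chartUInv x' y']; simp only [mul_assoc]
  · calc ((chartQ x y).transpose * E * chartQ x' y').transpose * chartT x y *
          ((chartQ x y).transpose * E * chartQ x' y')
        = (chartQ x' y').transpose * (E * (chartQ x y * (chartQ x y).transpose) * Lam *
            (chartQ x y * (chartQ x y).transpose) * E) * chartQ x' y' := by
          simp only [Matrix.transpose_mul, Matrix.transpose_transpose, hEt, mul_assoc, chartT]
      _ = chartT x' y' := by rw [hQQ, mul_one, mul_one, hELE, chartT]

/-! ### The Wilkinson shift in the chart. -/

theorem chartT_one_one (x y : ℝ) : chartT x y 1 1 =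
    (x ^ 2 / 4 - 1) * (invNormFirst x y ^ 2 - y ^ 2 * invNormLast x y ^ 2) := by
  have ha := invNormFirst_sq x y
  have hb := invNormLast_sq x y
  simp [chartT, chartQ, Lam, Matrix.mul_apply, Fin.sum_univ_three]
  generalize invNormFirst x y = a at *
  generalize invNormLast x y = b at *
  linear_combination (x ^ 2 / 4 - 1) * a ^ 2 * hb - (x ^ 2 / 4 - 1) * y ^ 2 * b ^ 2 * ha

theorem chartT_two_two (x y : ℝ) : chartT x y 2 2 =
    (x ^ 2 / 4 - 1) * (y ^ 2 * invNormLast x y ^ 2) := by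
  simp [chartT, chartQ, Lam, Matrix.mul_apply, Fin.sum_univ_three]
  ring

/-- The quadratic equals `(s + 1) s + x²/4 (s - 1) s + x² y² (s² - 1)`: up to normalization, the
corner cofactor of `s - T` expanded in the eigenbasis, weighted by the squared first column of
`chartQ`. -/
theorem mem_spectrum_bottomBlock {x y s : ℝ} : s ∈ spectrum ℝ (bottomBlock (chartT x y)) ↔
    normSqFirst x y * s ^ 2 - (x ^ 2 / 4 - 1) * s - x ^ 2 * y ^ 2 = 0 := by
  have ha := invNormFirst_sq x y
  have hb := invNormLast_sq x y
  have ha0 := invNormFirst_pos x y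
  have h12 : chartT x y 1 2 = chartT x y 2 1 := (isSymm_chartT x y).apply 2 1
  have h21 := chartT_two_one x y
  rw [mem_spectrum_iff_det, Matrix.det_fin_two]
  simp only [bottomBlock, h12, Matrix.sub_apply, Matrix.smul_apply, Matrix.one_apply_eq, smul_eq_mul,
    mul_one, Matrix.of_apply, Matrix.cons_val', Matrix.cons_val_zero, Matrix.cons_val_one,
    Matrix.cons_val_fin_one, chartT_one_one, chartT_two_two]
  simp only [ne_eq, zero_ne_one, one_ne_zero, not_false_eq_true, Matrix.one_apply_ne, mul_zero,
    zero_sub, normSqFirst]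
  generalize chartT x y 2 1 = c at *
  generalize invNormFirst x y = a at *
  generalize invNormLast x y = b at *
  have key : (s - (x ^ 2 / 4 - 1) * (a ^ 2 - y ^ 2 * b ^ 2)) *
      (s - (x ^ 2 / 4 - 1) * (y ^ 2 * b ^ 2)) - -c * -c = a ^ 2 *
      ((1 + x ^ 2 / 4 + x ^ 2 * y ^ 2) * s ^ 2 - (x ^ 2 / 4 - 1) * s - x ^ 2 * y ^ 2) := by
    linear_combination (-s ^ 2 + c ^ 2 + (x ^ 2 / 4 - 1) ^ 2 * y ^ 4 * b ^ 4 +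
        (1 + x ^ 2 / 4 + x ^ 2 * y ^ 2) * y ^ 2 * b ^ 4) * ha -
      (1 + x ^ 2 / 4 + x ^ 2 * y ^ 2) * (c * a + y * b ^ 2) * h21 -
      ((x ^ 2 / 4 - 1) ^ 2 * y ^ 2 * a ^ 2 * b ^ 2 +
        a ^ 2 * x ^ 2 * y ^ 2 * (b ^ 2 * (1 + y ^ 2 + x ^ 2 * y ^ 2 / 4) + 1)) * hb
  rw [key, mul_eq_zero, or_iff_right (pow_pos ha0 2).ne']

/-- The Wilkinson shift in logarithmic coordinates. -/
noncomputable def planeShift (p : ℝ × ℝ) : ℝ := tanh (-sgn (side p) * gap p)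

theorem one_add_tanh (h : ℝ) : 1 + tanh h = exp h / cosh h := by
  have := (cosh_pos h).ne'
  rw [tanh_eq_sinh_div_cosh, ← cosh_add_sinh]
  field_simp

theorem one_sub_tanh (h : ℝ) : 1 - tanh h = exp (-h) / cosh h := by
  have := (cosh_pos h).ne'
  rw [tanh_eq_sinh_div_cosh, ← cosh_sub_sinh]
  field_simp

theorem neg_one_lt_planeShift (p : ℝ × ℝ) : -1 < planeShift p := by
  have := one_add_tanh (-sgn (side p) * gap p)
  have h2 : 0 < exp (-sgn (side p) * gap p) / cosh (-sgn (side p) * gap p) :=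
    div_pos (exp_pos _) (cosh_pos _)
  unfold planeShift
  linarith

theorem planeShift_lt_one (p : ℝ × ℝ) : planeShift p < 1 := by
  have := one_sub_tanh (-sgn (side p) * gap p)
  have h2 : 0 < exp (-(-sgn (side p) * gap p)) / cosh (-sgn (side p) * gap p) :=
    div_pos (exp_pos _) (cosh_pos _)
  unfold planeShift
  linarith

theorem cosh_sgn_mul (t : Bool) (e : ℝ) : cosh (-sgn t * e) = cosh e := by
  cases t <;> simp [sgn]

theorem sinh_sgn_mul (t : Bool) (e : ℝ) : sinh (-sgn t * e) = -sgn t * sinh e := by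
  cases t <;> simp [sgn]

theorem planeShift_eq (p : ℝ × ℝ) :
    planeShift p = -sgn (side p) * (sinh (gap p) / cosh (gap p)) := by
  rw [planeShift, tanh_eq_sinh_div_cosh, sinh_sgn_mul, cosh_sgn_mul, mul_div_assoc]

theorem abs_planeShift (p : ℝ × ℝ) : |planeShift p| = sinh (gap p) / cosh (gap p) := by
  rw [planeShift_eq, abs_mul, abs_neg, abs_sgn, one_mul,
    abs_of_nonneg (div_nonneg (sinh_gap_nonneg p) (cosh_pos _).le)]

theorem sgn_mul_planeShift (p : ℝ × ℝ) : sgn (side p) * planeShift p ≤ 0 := by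
  have h : 0 ≤ sinh (gap p) / cosh (gap p) := div_nonneg (sinh_gap_nonneg p) (cosh_pos _).le
  rw [planeShift_eq]
  nlinarith [sgn_mul_self (side p)]

/-- For `s = tanh h` the quadratic reduces, after division by `exp u` and multiplication by `cosh²
h`, to `2 sinh h sinh (h - u) = q²`, which is `gap_eq` for `h = ∓gap`. -/
theorem planeShift_mem_spectrum (p : ℝ × ℝ) :
    planeShift p ∈ spectrum ℝ (bottomBlock (logChart p)) := by
  rw [logChart, mem_spectrum_bottomBlock, normSqFirst]
  have hg : 2 * (sinh (-sgn (side p) * gap p) * sinh (-sgn (side p) * gap p - p.1)) = p.2 ^ 2 := by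
    have h1 : p.1 = sgn (side p) * |p.1| := by
      rw [← sgn_side_mul, ← mul_assoc, sgn_mul_self, one_mul]
    have h2 : -sgn (side p) * gap p - p.1 = -sgn (side p) * (|p.1| + gap p) := by
      linear_combination -h1
    rw [h2, ← gap_eq p, sinh_sgn_mul, sinh_sgn_mul]
    linear_combination 2 * sinh (|p.1| + gap p) * sinh (gap p) * sgn_mul_self (side p)
  unfold planeShift
  generalize -sgn (side p) * gap p = h at *
  have e1 : exp (-p.1 / 2) * exp (-p.1 / 2) = (exp p.1)⁻¹ := by
    rw [← exp_add, ← exp_neg]; ring_nf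
  have e2 : (p.2 / 2 * exp (-p.1 / 2)) ^ 2 = p.2 ^ 2 / 4 * (exp p.1)⁻¹ := by
    rw [← e1]; ring
  rw [e2, ← hg, sinh_sub, sinh_eq, cosh_eq, tanh_eq_sinh_div_cosh, sinh_eq, cosh_eq, sinh_eq,
    exp_neg, exp_neg]
  have hE := exp_pos h
  have hW := exp_pos p.1
  generalize exp h = E at *
  generalize exp p.1 = W at *
  field_simp
  ring

/-- Since `(1 + tanh h) / (1 - tanh h) = exp (2 h)`, the scaling of `x` is a translation of `u`. The
weight `√(2 x)` in `q` cancels the remaining exponential in the rule for `y`. -/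
theorem planeShift_chart_eqs (p : ℝ × ℝ) :
    2 * exp (planeStep p).1 * (1 - planeShift p) = 2 * exp p.1 * (1 + planeShift p) ∧
    (planeStep p).2 / 2 * exp (-(planeStep p).1 / 2) * (1 + planeShift p) =
      |planeShift p| * (p.2 / 2 * exp (-p.1 / 2)) := by
  have hc := (cosh_pos (gap p)).ne'
  rw [abs_planeShift]
  unfold planeShift
  rw [one_add_tanh, one_sub_tanh, cosh_sgn_mul]
  simp only [planeStep, branch]
  constructor
  · have : exp (p.1 - 2 * sgn (side p) * gap p) * exp (-(-sgn (side p) * gap p)) =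
        exp p.1 * exp (-sgn (side p) * gap p) := by
      rw [← exp_add, ← exp_add]; ring_nf
    rw [mul_assoc, ← mul_div_assoc, this, mul_assoc, mul_div_assoc]
  · have : exp (-(p.1 - 2 * sgn (side p) * gap p) / 2) * exp (-sgn (side p) * gap p) =
        exp (-p.1 / 2) := by
      rw [← exp_add]; ring_nf
    rw [← this]
    field_simp

theorem exists_isQR_logChart (p : ℝ × ℝ) : ∃ Q R,
    IsQR (logChart p - planeShift p • (1 : Mat3)) Q R ∧
      Q.transpose * logChart p * Q = logChart (planeStep p) :=
  exists_isQR_chartT (neg_one_lt_planeShift p) (planeShift_lt_one p) (planeShift_chart_eqs p).1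
    (planeShift_chart_eqs p).2

/-- This quantity is the factor multiplying `x²/4 - 1` in `T 1 1 - T 2 2`; its positivity makes that
difference have the sign of `u`. -/
theorem two_mul_invNormLast_lt {p : ℝ × ℝ} (hu : |p.1| ≤ 1) (hq : |p.2| ≤ 1 / 100) {x y : ℝ}
    (hx : x = 2 * exp p.1) (hy : y = p.2 / 2 * exp (-p.1 / 2)) :
    0 < invNormFirst x y ^ 2 - 2 * (y ^ 2 * invNormLast x y ^ 2) := by
  have h1 : exp p.1 ≤ 3 :=
    (exp_le_exp.2 (abs_le.1 hu).2).trans (by linarith [exp_one_lt_d9])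
  have h2 : exp (-p.1) ≤ 3 :=
    (exp_le_exp.2 (by linarith [(abs_le.1 hu).1] : -p.1 ≤ 1)).trans (by linarith [exp_one_lt_d9])
  have h3 : p.2 ^ 2 ≤ 1 / 10000 := by
    rw [← sq_abs]; nlinarith [abs_nonneg p.2]
  have e1 : exp (-p.1 / 2) * exp (-p.1 / 2) = exp (-p.1) := by
    rw [← exp_add]; ring_nf
  have e2 : exp p.1 * exp (-p.1) = 1 := by rw [← exp_add]; simp
  have hy2 : y ^ 2 = p.2 ^ 2 / 4 * exp (-p.1) := by rw [hy, ← e1]; ring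
  have hxy : x ^ 2 * y ^ 2 = p.2 ^ 2 * exp p.1 := by
    rw [hy2, hx]; linear_combination p.2 ^ 2 * exp p.1 * e2
  have hy2' : y ^ 2 ≤ 1 / 10000 := by rw [hy2]; nlinarith [exp_pos (-p.1), sq_nonneg p.2]
  have hxy' : x ^ 2 * y ^ 2 ≤ 3 / 10000 := by rw [hxy]; nlinarith [exp_pos p.1, sq_nonneg p.2]
  have ha := invNormFirst_sq x y
  have hb := invNormLast_sq x y
  have ha0 := invNormFirst_pos x y
  have hb0 := invNormLast_pos x y
  have key : invNormFirst x y ^ 2 - 2 * (y ^ 2 * invNormLast x y ^ 2) =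
      invNormFirst x y ^ 2 * invNormLast x y ^ 2 *
        (1 - y ^ 2 - x ^ 2 * y ^ 2 / 4 - 2 * (x ^ 2 * y ^ 2) * y ^ 2) := by
    linear_combination -invNormFirst x y ^ 2 * hb + 2 * y ^ 2 * invNormLast x y ^ 2 * ha
  rw [key]
  have : 0 < 1 - y ^ 2 - x ^ 2 * y ^ 2 / 4 - 2 * (x ^ 2 * y ^ 2) * y ^ 2 := by
    nlinarith [sq_nonneg y, mul_nonneg (sq_nonneg x) (sq_nonneg y)]
  positivity

/-- For the two eigenvalues, `(μ - T₃₃)² - (s - T₃₃)² = (μ - s) (T₂₂ - T₃₃)` by the trace. Both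
factors on the right have the sign of `u`, because `s` has the opposite sign and the trace has the
sign of `u`. -/
theorem isShift_planeShift {p : ℝ × ℝ} (hu : |p.1| ≤ 1) (hq : |p.2| ≤ 1 / 100)
    (h : p.1 ≠ 0 ∨ p.2 = 0) : IsShift (logChart p) (planeShift p) := by
  have hs := planeShift_mem_spectrum p
  refine ⟨hs, fun μ hμ hne => sq_lt_sq.1 ?_⟩
  obtain ⟨x, hx⟩ : ∃ x, 2 * exp p.1 = x := ⟨_, rfl⟩
  obtain ⟨y, hy⟩ : ∃ y, p.2 / 2 * exp (-p.1 / 2) = y := ⟨_, rfl⟩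
  have hpos := two_mul_invNormLast_lt hu hq hx.symm hy.symm
  have hsgn := sgn_mul_planeShift p
  have hside := sgn_side_mul p
  have hz : x ^ 2 / 4 - 1 = exp p.1 * exp p.1 - 1 := by rw [← hx]; ring
  have ha := invNormFirst_sq x y
  simp only [logChart, hx, hy, mem_spectrum_bottomBlock, chartT_two_two] at hs hμ ⊢
  generalize planeShift p = s at *
  have hN := normSqFirst_pos x y
  have hsum : normSqFirst x y * (μ + s) = x ^ 2 / 4 - 1 := by
    refine mul_left_cancel₀ (sub_ne_zero.2 hne) ?_
    linear_combination hμ - hs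
  have hsum' : μ + s = (x ^ 2 / 4 - 1) * invNormFirst x y ^ 2 := by
    rw [← hsum, normSqFirst]
    linear_combination -(μ + s) * ha
  set w := invNormFirst x y ^ 2 - 2 * (y ^ 2 * invNormLast x y ^ 2)
  have key : (μ - (x ^ 2 / 4 - 1) * (y ^ 2 * invNormLast x y ^ 2)) ^ 2 -
      (s - (x ^ 2 / 4 - 1) * (y ^ 2 * invNormLast x y ^ 2)) ^ 2 =
      (μ - s) * ((x ^ 2 / 4 - 1) * w) := by
    simp only [w]
    linear_combination (μ - s) * hsum'
  rw [← sub_pos, key]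
  rcases lt_trichotomy p.1 0 with h0 | h0 | h0
  · have hz0 : x ^ 2 / 4 - 1 < 0 := by
      rw [hz]
      nlinarith [exp_pos p.1, (by simpa using h0 : exp p.1 < 1)]
    have hs0 : 0 ≤ s := by
      rw [side, decide_eq_false (not_lt.2 h0.le)] at hsgn
      simpa [sgn] using hsgn
    exact mul_pos_of_neg_of_neg (by nlinarith) (mul_neg_of_neg_of_pos hz0 hpos)
  -- At the origin the block has the double eigenvalue `0`, so there is no competitor `μ`.
  · have hq0 : p.2 = 0 := h.resolve_left (by simp [h0])
    have hy0 : y = 0 := by rw [← hy, hq0]; ring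
    have hx0 : x ^ 2 / 4 - 1 = 0 := by rw [hz, h0]; simp
    rw [hx0, hy0] at hs hμ
    have e1 : s = 0 := by
      have : normSqFirst x 0 * s ^ 2 = 0 := by linear_combination hs
      simpa [(normSqFirst_pos x 0).ne'] using this
    have e2 : μ = 0 := by
      have : normSqFirst x 0 * μ ^ 2 = 0 := by linear_combination hμ
      simpa [(normSqFirst_pos x 0).ne'] using this
    exact absurd (e2.trans e1.symm) hne
  · have hz0 : 0 < x ^ 2 / 4 - 1 := by
      rw [hz]
      nlinarith [exp_pos p.1, one_lt_exp_iff.2 h0]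
    have hs0 : s ≤ 0 := by
      rw [side, decide_eq_true h0] at hsgn
      simpa [sgn] using hsgn
    exact mul_pos (by nlinarith) (mul_pos hz0 hpos)

/-- On `u = 0` the block has trace zero and zero corner entry, so its eigenvalues `±s`, nonzero for
`q ≠ 0`, are equally close. -/
theorem not_isShift_logChart {p : ℝ × ℝ} (h1 : p.1 = 0) (h2 : p.2 ≠ 0) (s : ℝ) :
    ¬ IsShift (logChart p) s := by
  rintro ⟨hs, hlt⟩
  have hy : p.2 / 2 * exp (-p.1 / 2) ≠ 0 := by positivity
  simp only [logChart, h1, exp_zero, mul_one] at hs hlt hy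
  generalize p.2 / 2 * exp (-0 / 2) = y at *
  have h22 : chartT 2 y 2 2 = 0 := by rw [chartT_two_two]; norm_num
  have hs' := mem_spectrum_bottomBlock.1 hs
  have hneg : -s ∈ spectrum ℝ (bottomBlock (chartT 2 y)) := by
    rw [mem_spectrum_bottomBlock]
    linear_combination hs'
  have hs0 : s ≠ 0 := by
    rintro rfl
    simp [hy] at hs'
  have := hlt (-s) hneg fun h => hs0 (by linarith)
  rw [h22] at this
  simp at this

/-- Wilkinson's step in logarithmic coordinates. -/
theorem step_logChart_iff {p : ℝ × ℝ} (hu : |p.1| ≤ 1) (hq : |p.2| ≤ 1 / 100) {T' : Mat3} :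
    Step (logChart p) T' ↔ (p.1 ≠ 0 ∨ p.2 = 0) ∧ T' = logChart (planeStep p) := by
  obtain ⟨Q, R, hQR, hT'⟩ := exists_isQR_logChart p
  constructor
  · rintro ⟨s, Q', R', hs, hQR', rfl⟩
    have h : p.1 ≠ 0 ∨ p.2 = 0 := by
      by_contra! h
      exact not_isShift_logChart h.1 h.2 s hs
    obtain rfl := hs.unique (isShift_planeShift hu hq h)
    exact ⟨h, (hQR'.conj_unique (isSymm_chartT _ _) hQR).trans hT'⟩
  · rintro ⟨h, rfl⟩
    exact ⟨_, Q, R, isShift_planeShift hu hq h, hQR, hT'.symm⟩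

/-! ### Transfer from the plane to matrices. -/

/-- A neighbourhood of the origin in logarithmic coordinates. -/
def box : Set (ℝ × ℝ) := {p | |p.1| < 1 ∧ |p.2| < 1 / 100}

/-- A neighbourhood of `P₀` in the isospectral manifold. -/
def nbhd : Set Mat3 := (logDomain ∩ logCoord ⁻¹' box) ∩ isospectral

/-- The points of `nbhd` whose orbit converges to `P₀`. -/
def stableMat : Set Mat3 :=
  {T | T ∈ nbhd ∧ ∃ S : ℕ → Mat3, S 0 = T ∧ IsOrbit S ∧ Tendsto S atTop (𝓝 P₀)}

theorem isOpen_box : IsOpen box := by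
  have h1 : IsOpen {p : ℝ × ℝ | |p.1| < 1} := isOpen_lt (by fun_prop) (by fun_prop)
  have h2 : IsOpen {p : ℝ × ℝ | |p.2| < 1 / 100} := isOpen_lt (by fun_prop) (by fun_prop)
  exact h1.inter h2

theorem mem_nbhd_iff {T : Mat3} : T ∈ nbhd ↔ ∃ p ∈ box, logChart p = T := by
  constructor
  · rintro ⟨⟨h1, h2⟩, h3⟩
    exact ⟨logCoord T, h2, logChart_logCoord h3 h1⟩
  · rintro ⟨p, hp, rfl⟩
    refine ⟨⟨logChart_mem_logDomain p, ?_⟩, chartT_mem_isospectral _ _⟩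
    rwa [Set.mem_preimage, logCoord_logChart]

theorem planeStep_mem_box {p : ℝ × ℝ} (h : p ∈ box) : planeStep p ∈ box := by
  refine ⟨(abs_planeStep_fst_le p).trans_lt (max_lt h.1 ?_), ?_⟩
  · linarith [h.2]
  · have h1 := abs_branch_snd_le_div (side p) h.2.le
    have h2 := h.2
    have h3 := abs_nonneg p.2
    rw [planeStep]
    linarith

theorem iterate_mem_box {p : ℝ × ℝ} (h : p ∈ box) (n : ℕ) : planeStep^[n] p ∈ box := by
  induction n with
  | zero => exact h
  | succ n ih =>
    rw [Function.iterate_succ_apply']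
    exact planeStep_mem_box ih

theorem IsOrbit.eq_logChart {S : ℕ → Mat3} (hS : IsOrbit S) {p : ℝ × ℝ} (hp : p ∈ box)
    (h0 : S 0 = logChart p) (n : ℕ) : S n = logChart (planeStep^[n] p) := by
  induction n with
  | zero => exact h0
  | succ n ih =>
    have hb := iterate_mem_box hp n
    have h := hS n
    rw [ih, step_logChart_iff hb.1.le hb.2.le] at h
    rw [h.2, Function.iterate_succ_apply']

theorem step_logChart_iff_of_stable {p : ℝ × ℝ} (hp : p ∈ box) (h : p ∈ stableSet) {T' : Mat3} :
    Step (logChart p) T' ↔ T' = logChart (planeStep p) := by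
  rw [step_logChart_iff hp.1.le hp.2.le, and_iff_right]
  by_contra! h0
  have h1 := (h 0).2.2
  simp [h0.1] at h1
  exact h0.2 h1

/-- The box is forward invariant, so an entire matrix orbit starting in it is the image of a plane
orbit; continuity of the chart and its inverse at the limit transfers convergence. -/
theorem mem_stableMat_iff {T : Mat3} :
    T ∈ stableMat ↔ ∃ p ∈ box ∩ stableSet, logChart p = T := by
  constructor
  · rintro ⟨hT, S, rfl, hS, hlim⟩
    obtain ⟨p, hp, hpT⟩ := mem_nbhd_iff.1 hT
    refine ⟨p, ⟨hp, mem_stableSet_of_tendsto hp.2.le ?_⟩, hpT⟩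
    have h1 : ContinuousAt logCoord P₀ := by
      refine continuousOn_logCoord.continuousAt (isOpen_logDomain.mem_nhds ?_)
      rw [← logChart_zero]
      exact logChart_mem_logDomain 0
    have h2 := h1.tendsto.comp hlim
    rw [← logChart_zero, logCoord_logChart] at h2
    refine h2.congr fun n => ?_
    rw [Function.comp_apply, hS.eq_logChart hp hpT.symm, logCoord_logChart]
  · rintro ⟨p, ⟨hp, h⟩, rfl⟩
    refine ⟨mem_nbhd_iff.2 ⟨p, hp, rfl⟩, fun n => logChart (planeStep^[n] p), rfl, fun n => ?_, ?_⟩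
    · exact (step_logChart_iff_of_stable (iterate_mem_box hp n) (iterate_mem_stableSet h n)).2
        (by simp only [Function.iterate_succ_apply'])
    · rw [← logChart_zero]
      exact (continuous_logChart.tendsto 0).comp (tendsto_of_mem_stableSet h)

theorem closure_stableMat_inter : stableMat = closure stableMat ∩ nbhd := by
  refine Set.Subset.antisymm (fun T hT => ⟨subset_closure hT, hT.1⟩) ?_
  rintro T ⟨hcl, hT⟩
  have h1 : ContinuousAt logCoord T :=
    continuousOn_logCoord.continuousAt (isOpen_logDomain.mem_nhds hT.1.1)
  have h2 := h1.continuousWithinAt.mem_closure_image hcl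
  have h3 : logCoord '' stableMat ⊆ stableSet := by
    rintro _ ⟨T', hT', rfl⟩
    obtain ⟨p, hp, rfl⟩ := mem_stableMat_iff.1 hT'
    rw [logCoord_logChart]
    exact hp.2
  have h4 := closure_minimal h3 isClosed_stableSet h2
  exact mem_stableMat_iff.2 ⟨logCoord T, ⟨hT.1.2, h4⟩, logChart_logCoord hT.2 hT.1.1⟩

/-- The change from logarithmic to bidiagonal coordinates is differentiable, so it maps null sets to
null sets. -/
theorem volume_coords_stableMat :
    volume {p : ℝ × ℝ | ∃ T ∈ stableMat, HasCoords T p.1 p.2} = 0 := by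
  let g : ℝ × ℝ → ℝ × ℝ := fun p => (2 * exp p.1, p.2 / 2 * exp (-p.1 / 2))
  have hg : DifferentiableOn ℝ g stableSet := by
    have : Differentiable ℝ g := by fun_prop
    exact this.differentiableOn
  refine measure_mono_null ?_
    (addHaar_image_eq_zero_of_differentiableOn_of_addHaar_eq_zero volume hg volume_stableSet)
  rintro r ⟨T, hT, hr⟩
  obtain ⟨p, hp, rfl⟩ := mem_stableMat_iff.1 hT
  obtain ⟨h1, h2⟩ := hasCoords_logChart_iff.1 hr
  exact ⟨p, hp.2, Prod.ext h1.symm h2.symm⟩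

/-- On the box the normalizing factors are bounded above and below, so `T₃₂` is comparable to `q`
and inherits its rate of convergence. -/
theorem abs_logChart_two_one_bounds {p : ℝ × ℝ} (hp : p ∈ box) :
    |p.2| / 8 ≤ |logChart p 2 1| ∧ |logChart p 2 1| ≤ 4 * |p.2| := by
  obtain ⟨hu, hq⟩ := hp
  obtain ⟨x, hx⟩ : ∃ x, 2 * exp p.1 = x := ⟨_, rfl⟩
  obtain ⟨y, hy⟩ : ∃ y, p.2 / 2 * exp (-p.1 / 2) = y := ⟨_, rfl⟩
  obtain ⟨hu1, hu2⟩ := abs_lt.1 hu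
  have h1 : exp p.1 ≤ 3 := (exp_le_exp.2 hu2.le).trans (by linarith [exp_one_lt_d9])
  have h2 : exp (-p.1 / 2) ≤ 2 := by
    have h3 : exp (-p.1 / 2) * exp (-p.1 / 2) ≤ 4 := by
      rw [← exp_add, show -p.1 / 2 + -p.1 / 2 = -p.1 by ring]
      exact (exp_le_exp.2 (by linarith : -p.1 ≤ 1)).trans (by linarith [exp_one_lt_d9])
    nlinarith [exp_pos (-p.1 / 2)]
  have h3 : 1 / 2 ≤ exp (-p.1 / 2) := by linarith [add_one_le_exp (-p.1 / 2)]
  have hya : |y| = |p.2| / 2 * exp (-p.1 / 2) := by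
    rw [← hy, abs_mul, abs_div, abs_two, abs_of_pos (exp_pos _)]
  have hy1 : |p.2| / 4 ≤ |y| := by rw [hya]; nlinarith [abs_nonneg p.2]
  have hy2 : |y| ≤ |p.2| := by rw [hya]; nlinarith [abs_nonneg p.2]
  have hy3 : y ^ 2 ≤ 1 / 10000 := by
    rw [← sq_abs]; nlinarith [abs_nonneg y]
  have hx1 : x ^ 2 ≤ 36 := by rw [← hx]; nlinarith [exp_pos p.1]
  have hxy : x ^ 2 * y ^ 2 ≤ 36 / 10000 := by nlinarith [sq_nonneg x, sq_nonneg y]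
  have hxy0 : 0 ≤ x ^ 2 * y ^ 2 := by positivity
  have ha := invNormFirst_sq x y
  have hb := invNormLast_sq x y
  have ha0 := invNormFirst_pos x y
  have hb0 := invNormLast_pos x y
  have key := chartT_two_one x y
  rw [logChart, hx, hy]
  generalize invNormFirst x y = a at *
  generalize invNormLast x y = b at *
  generalize chartT x y 2 1 = c at *
  have key2 : |c| * a = |y| * b ^ 2 := by
    have := congrArg abs key
    rwa [abs_mul, abs_mul, abs_of_pos ha0, abs_of_nonneg (sq_nonneg b)] at this
  have hc := abs_nonneg c
  have hyn := abs_nonneg y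
  have b1 : b ^ 2 ≤ 1 := by
    refine (le_mul_of_one_le_right (sq_nonneg b) ?_).trans hb.le
    linarith [sq_nonneg y]
  have b2 : 1 / 2 ≤ b ^ 2 := by
    have := mul_le_mul_of_nonneg_left
      (by linarith : 1 + y ^ 2 + x ^ 2 * y ^ 2 / 4 ≤ 2) (sq_nonneg b)
    linarith
  have a1 : a ≤ 1 := by
    refine (sq_le_one_iff₀ ha0.le).1 ((le_mul_of_one_le_right (sq_nonneg a) ?_).trans ha.le)
    linarith [sq_nonneg x]
  have a2 : 1 / 4 ≤ a := by
    refine (sq_le_sq₀ (by norm_num) ha0.le).1 ?_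
    have := mul_le_mul_of_nonneg_left
      (by linarith : 1 + x ^ 2 / 4 + x ^ 2 * y ^ 2 ≤ 16) (sq_nonneg a)
    linarith
  constructor
  · have e1 : |c| * a ≤ |c| := mul_le_of_le_one_right hc a1
    have e2 : |p.2| / 4 * (1 / 2) ≤ |y| * b ^ 2 := mul_le_mul hy1 b2 (by norm_num) hyn
    linarith
  · have e1 : |c| * (1 / 4) ≤ |c| * a := mul_le_mul_of_nonneg_left a2 hc
    have e2 : |y| * b ^ 2 ≤ |y| := mul_le_of_le_one_right hyn b1
    linarith

/-- The constants combine `q² / 6 ≤ |q'| ≤ 3/4 q²` with the comparison bounds: `768 = 8 * 6 * 4²`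
and `192 = 4 * (3/4) * 8²`. -/
theorem strictly_quadratic {p : ℝ × ℝ} (hp : p ∈ box) (h : p ∈ stableSet) :
    1 / 768 * |logChart p 2 1| ^ 2 ≤ |logChart (planeStep p) 2 1| ∧
      |logChart (planeStep p) 2 1| ≤ 192 * |logChart p 2 1| ^ 2 := by
  obtain ⟨h1, h2⟩ := abs_logChart_two_one_bounds hp
  obtain ⟨h3, h4⟩ := abs_logChart_two_one_bounds (planeStep_mem_box hp)
  have h5 := abs_branch_snd_le (side p) p
  have h6 := le_abs_branch_snd (side p) (h 0).2.1 (h 0).1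
  have h7 := abs_nonneg p.2
  have h8 := abs_nonneg (logChart p 2 1)
  rw [Function.iterate_zero_apply] at h6
  change _ ≤ |(planeStep p).2| at h6
  change |(planeStep p).2| ≤ _ at h5
  constructor
  · have : |logChart p 2 1| ^ 2 ≤ (4 * |p.2|) ^ 2 := by gcongr
    linarith
  · have : (|p.2| / 8) ^ 2 ≤ |logChart p 2 1| ^ 2 := by gcongr
    linarith

theorem stablePos_subset_box : stablePos ⊆ box := fun p hp => by
  have h1 := (hp.1 0).2.1
  have h2 := hp.2.2
  rw [Function.iterate_zero_apply, abs_of_pos hp.2.1] at h1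
  refine ⟨by linarith, ?_⟩
  rwa [abs_of_pos hp.2.1]

theorem mem_upper_iff {T : Mat3} :
    (T ∈ stableMat ∧ ∃ x y : ℝ, HasCoords T x y ∧ 0 < y) ↔ ∃ p ∈ stablePos, logChart p = T := by
  constructor
  · rintro ⟨hT, x, y, hxy, hy⟩
    obtain ⟨p, ⟨hp, hs⟩, rfl⟩ := mem_stableMat_iff.1 hT
    refine ⟨p, ⟨hs, ?_, (abs_lt.1 hp.2).2⟩, rfl⟩
    rw [(hasCoords_logChart_iff.1 hxy).2] at hy
    have := pos_of_mul_pos_left hy (exp_pos _).le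
    linarith
  · rintro ⟨p, hp, rfl⟩
    refine ⟨mem_stableMat_iff.2 ⟨p, ⟨stablePos_subset_box hp, hp.1⟩, rfl⟩, _, _,
      hasCoords_logChart_iff.2 ⟨rfl, rfl⟩, ?_⟩
    have := hp.2.1
    positivity

theorem logCoord_mem_stablePos {T : Mat3}
    (h : T ∈ stableMat ∧ ∃ x y : ℝ, HasCoords T x y ∧ 0 < y) : logCoord T ∈ stablePos := by
  obtain ⟨p, hp, rfl⟩ := mem_upper_iff.1 h
  rwa [logCoord_logChart]

/-- The logarithmic chart on the upper part of the stable set. -/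
noncomputable def upperHomeomorph :
    {T : Mat3 | T ∈ stableMat ∧ ∃ x y : ℝ, HasCoords T x y ∧ 0 < y} ≃ₜ stablePos where
  toFun T := ⟨logCoord T.1, logCoord_mem_stablePos T.2⟩
  invFun p := ⟨logChart p.1, mem_upper_iff.2 ⟨p.1, p.2, rfl⟩⟩
  left_inv T := Subtype.ext (logChart_logCoord T.2.1.1.2 T.2.1.1.1.1)
  right_inv p := Subtype.ext (logCoord_logChart p.1)
  continuous_toFun := Continuous.subtype_mk
    (continuousOn_logCoord.comp_continuous continuous_subtype_val fun T => T.2.1.1.1.1) fun T =>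
    logCoord_mem_stablePos T.2
  continuous_invFun := (continuous_logChart.comp continuous_subtype_val).subtype_mk _

/-- Rescaling of an open interval. -/
noncomputable def intervalHomeomorph : Set.Ioo (0 : ℝ) (1 / 100) ≃ₜ Set.Ioo (0 : ℝ) 1 :=
  (Homeomorph.mulLeft₀ (100 : ℝ) (by norm_num)).subtype fun x => by
    change 0 < x ∧ x < 1 / 100 ↔ 0 < 100 * x ∧ 100 * x < 1
    constructor <;> rintro ⟨h1, h2⟩ <;> constructor <;> linarith

end Wilkinson

theorem theorem5p1 :
    ∃ A X : Set Wilkinson.Mat3,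
      -- `A` is an open neighbourhood of `P₀` in the isospectral manifold
      (∃ O : Set Wilkinson.Mat3, IsOpen O ∧ A = O ∩ Wilkinson.isospectral) ∧
      Wilkinson.P₀ ∈ A ∧
      A ⊆ Wilkinson.chartDomain ∧
      -- `X` consists of all initial conditions in `A` whose iteration converges to `P₀`
      X = {T | T ∈ A ∧ ∃ S : ℕ → Wilkinson.Mat3,
        S 0 = T ∧ Wilkinson.IsOrbit S ∧ Tendsto S atTop (𝓝 Wilkinson.P₀)} ∧
      -- `X` is relatively closed in `A`
      (∃ F : Set Wilkinson.Mat3, IsClosed F ∧ X = F ∩ A) ∧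
      -- `X` has zero measure (in the chart)
      volume {p : ℝ × ℝ | ∃ T ∈ X, Wilkinson.HasCoords T p.1 p.2} = 0 ∧
      -- the step is a well defined map on `X` and sends `X` to itself
      (∀ T ∈ X, ∃ T' ∈ X, ∀ T'' : Wilkinson.Mat3, Wilkinson.Step T T'' ↔ T'' = T') ∧
      -- on `X` the iteration converges to `P₀`, at a strictly quadratic rate
      (∀ S : ℕ → Wilkinson.Mat3, S 0 ∈ X → Wilkinson.IsOrbit S →
        Tendsto S atTop (𝓝 Wilkinson.P₀) ∧
        ∃ c C : ℝ, 0 < c ∧ 0 < C ∧ ∀ k,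
          c * |S k 2 1| ^ 2 ≤ |S (k + 1) 2 1| ∧ |S (k + 1) 2 1| ≤ C * |S k 2 1| ^ 2) ∧
      -- the part with positive `y` is a Cantor set times an open interval
      Nonempty ({T : Wilkinson.Mat3 | T ∈ X ∧ ∃ x y : ℝ, Wilkinson.HasCoords T x y ∧ 0 < y} ≃ₜ
        cantorSet × Set.Ioo (0 : ℝ) 1) := by
  open Wilkinson in
  refine ⟨nbhd, stableMat, ⟨_, continuousOn_logCoord.isOpen_inter_preimage isOpen_logDomain
    isOpen_box, rfl⟩, ?_, ?_, rfl, ⟨_, isClosed_closure, closure_stableMat_inter⟩,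
    volume_coords_stableMat, ?_, ?_, ?_⟩
  · exact mem_nbhd_iff.2 ⟨0, by norm_num [box], logChart_zero⟩
  · intro T hT
    obtain ⟨p, -, rfl⟩ := mem_nbhd_iff.1 hT
    exact ⟨hT.2, _, _, hasCoords_logChart_iff.2 ⟨rfl, rfl⟩⟩
  · intro T hT
    obtain ⟨p, ⟨hp, hs⟩, rfl⟩ := mem_stableMat_iff.1 hT
    exact ⟨logChart (planeStep p), mem_stableMat_iff.2
      ⟨_, ⟨planeStep_mem_box hp, planeStep_mem_stableSet hs⟩, rfl⟩,
      fun T'' => step_logChart_iff_of_stable hp hs⟩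
  · intro S h0 hS
    obtain ⟨p, ⟨hp, hs⟩, h⟩ := mem_stableMat_iff.1 h0
    have hSn := hS.eq_logChart hp h.symm
    constructor
    · rw [← logChart_zero]
      exact ((continuous_logChart.tendsto 0).comp (tendsto_of_mem_stableSet hs)).congr
        fun n => (hSn n).symm
    · refine ⟨1 / 768, 192, by norm_num, by norm_num, fun n => ?_⟩
      rw [hSn, hSn, Function.iterate_succ_apply']
      exact strictly_quadratic (iterate_mem_box hp n) (iterate_mem_stableSet hs n)
  · exact ⟨upperHomeomorph.trans (stableHomeomorph.trans
      (cantorSetHomeomorphNatToBool.symm.prodCongr intervalHomeomorph))⟩
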